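/- For $N\ge 1$ write points of $\mathbb R^N$ as $x=(x',x_N)$ with $x'\in\mathbb R^{N-1}$, and let $\mathbb B^N$ be the open unit ball. A *special Lipschitz domain* is a set $\omega=\{(x',x_N)\in\mathbb R^N : x_N>\rho(x')\}$ where $\rho:\mathbb R^{N-1}\to\mathbb R$ is Lipschitz with $\sup|\rho|+\operatorname{Lip}(\rho)<\tfrac12$. A *bounded Lipschitz domain* is a bounded open set $\Omega\subset\mathbb R^N$ such that for every $q\in\partial\Omega$ there are an invertible affine map $\Phi:\mathbb R^N\to\mathbb R^N$ and a special Lipschitz domain $\omega$ with $q\in\Phi(\mathbb B^N)$ and $\Omega\cap\Phi(\mathbb B^N)=\Phi(\omega\cap\mathbb B^N)$. Functions are complex-valued, $D^\gamma$ denotes weak derivatives, and $\|u\|_{W^{l,p}(\Omega)}=\sum_{|\alpha|\le l}\|D^\alpha u\|_{L^p(\Omega)}$. **Proposition.** Let $1<p<\infty$, let $k,l$ be non-negative integers with $l<k$, let $\Omega\subset\mathbb R^N$ ($N\ge1$) be a bounded Lipschitz domain, and let $\delta(x)=\operatorname{dist}(x,\partial\Omega)$. There is a constant $C$, independent of $u$,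 such that the following holds. If $u\in W^{k,p}_{\mathrm{loc}}(\Omega)$ and $$\sum_{|\gamma|\le k}\|\delta^{k-l}D^\gamma u\|_{L^p(\Omega)}<\infty,$$ then $u\in W^{l,p}(\Omega)$ and $$\|u\|_{W^{l,p}(\Omega)}\le C\sum_{|\gamma|\le k}\|\delta^{k-l}D^\gamma u\|_{L^p(\Omega)}.$$ -/

import Mathlib

open MeasureTheory Set
open scoped ENNReal NNReal

noncomputable section

namespace WeightedSobolev

/-- Euclidean space `ℝ^N`. -/
abbrev Eucl (N : ℕ) : Type := EuclideanSpace ℝ (Fin N)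

/-! ### Lipschitz domains -/

/-- The first `d` coordinates `x'` of a point `x = (x', x_{d+1})` of `ℝ^{d+1}`. -/
def head {d : ℕ} (x : Eucl (d + 1)) : Eucl d :=
  WithLp.toLp 2 fun i : Fin d => x i.castSucc

/-- The region `{(x', x_{d+1}) : x_{d+1} > ρ(x')}` above the graph of `ρ`. -/
def epigraph {d : ℕ} (ρ : Eucl d → ℝ) : Set (Eucl (d + 1)) :=
  {x | ρ (head x) < x (Fin.last d)}

/-- Special Lipschitz domains: regions above the graph of a function `ρ` for which `sup |ρ|` plus
the Lipschitz constant of `ρ` (this is `sup |∇ρ|`) is less than `1/2`. -/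
def IsSpecialLipschitzDomain {d : ℕ} (ω : Set (Eucl (d + 1))) : Prop :=
  ∃ (ρ : Eucl d → ℝ) (M : ℝ) (K : ℝ≥0),
    (∀ x, |ρ x| ≤ M) ∧ LipschitzWith K ρ ∧ M + K < 1 / 2 ∧ ω = epigraph ρ

/-- Bounded Lipschitz domains: bounded open sets which, near each boundary point, are the image of
a special Lipschitz domain under an invertible affine map (restricted to the unit ball). -/
def IsBoundedLipschitzDomain {d : ℕ} (Ω : Set (Eucl (d + 1))) : Prop :=
  IsOpen Ω ∧ Bornology.IsBounded Ω ∧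
    ∀ q ∈ frontier Ω, ∃ (Φ : Eucl (d + 1) ≃ᵃ[ℝ] Eucl (d + 1)) (ω : Set (Eucl (d + 1))),
      IsSpecialLipschitzDomain ω ∧
      q ∈ Φ '' Metric.ball 0 1 ∧
      Ω ∩ Φ '' Metric.ball 0 1 = Φ '' (ω ∩ Metric.ball 0 1)

/-- The distance to the boundary of `Ω`. -/
def bdryDist {N : ℕ} (Ω : Set (Eucl N)) (x : Eucl N) : ℝ :=
  Metric.infDist x (frontier Ω)

/-! ### Multi-indices and weak derivatives -/

/-- Multi-indices `γ = (γ_1, …, γ_N)`. -/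
abbrev MultiIndex (N : ℕ) : Type := Fin N → ℕ

/-- The order `|γ| = γ_1 + ⋯ + γ_N`. -/
def MultiIndex.order {N : ℕ} (γ : MultiIndex N) : ℕ := ∑ i, γ i

/-- The finite set of multi-indices of order at most `k`. -/
def multiIndices (N k : ℕ) : Finset (MultiIndex N) :=
  (Finset.Iic fun _ => k).filter fun γ => γ.order ≤ k

theorem mem_multiIndices {N k : ℕ} {γ : MultiIndex N} :
    γ ∈ multiIndices N k ↔ γ.order ≤ k := by
  simp only [multiIndices, Finset.mem_filter, Finset.mem_Iic, and_iff_right_iff_imp]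
  intro h i
  exact (Finset.single_le_sum (f := γ) (fun _ _ => Nat.zero_le _) (Finset.mem_univ i)).trans h

/-- The classical partial derivative `∂φ/∂x_i`. -/
def partialDeriv {N : ℕ} (i : Fin N) (φ : Eucl N → ℝ) (x : Eucl N) : ℝ :=
  fderiv ℝ φ x (EuclideanSpace.single i 1)

/-- The classical derivative `∂_1^{γ_1} ⋯ ∂_N^{γ_N} φ` (used for smooth functions `φ` only). -/
def multiDeriv {N : ℕ} (γ : MultiIndex N) (φ : Eucl N → ℝ) : Eucl N → ℝ :=
  (List.finRange N).foldr (fun i f => (partialDeriv i)^[γ i] f) φ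

/-- `g` is a weak (distributional) derivative `D^γ u` on `Ω`; both are locally integrable. -/
structure HasWeakDeriv {N : ℕ} (Ω : Set (Eucl N)) (γ : MultiIndex N) (u g : Eucl N → ℂ) :
    Prop where
  locallyIntegrableOn : LocallyIntegrableOn u Ω
  locallyIntegrableOn_deriv : LocallyIntegrableOn g Ω
  integral_eq : ∀ φ : Eucl N → ℝ, ContDiff ℝ (⊤ : ℕ∞) φ → HasCompactSupport φ → tsupport φ ⊆ Ω →
    ∫ x in Ω, multiDeriv γ φ x • u x = (-1 : ℂ) ^ γ.order * ∫ x in Ω, φ x • g x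

/-- Weak derivatives on an open set are unique up to null sets. -/
theorem HasWeakDeriv.ae_unique {N : ℕ} {Ω : Set (Eucl N)} (hΩ : IsOpen Ω) {γ : MultiIndex N}
    {u g₁ g₂ : Eucl N → ℂ} (h₁ : HasWeakDeriv Ω γ u g₁) (h₂ : HasWeakDeriv Ω γ u g₂) :
    ∀ᵐ x, x ∈ Ω → g₁ x = g₂ x := by
  have key : ∀ᵐ x, x ∈ Ω → (g₁ - g₂) x = 0 := by
    apply hΩ.ae_eq_zero_of_integral_contDiff_smul_eq_zero
      (h₁.locallyIntegrableOn_deriv.sub h₂.locallyIntegrableOn_deriv)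
    intro φ hφ hc hs
    have hint : ∀ g : Eucl N → ℂ, LocallyIntegrableOn g Ω → Integrable (fun x => φ x • g x) := by
      intro g hg
      have hK : IntegrableOn g (tsupport φ) := hg.integrableOn_compact_subset hs hc
      refine (integrableOn_iff_integrable_of_support_subset ?_).1
        (hK.continuousOn_smul hφ.continuous.continuousOn hc)
      exact (Function.support_smul_subset_left φ g).trans (subset_tsupport φ)
    have hset : ∀ g : Eucl N → ℂ, ∫ x in Ω, φ x • g x = ∫ x, φ x • g x := by
      intro g
      refine setIntegral_eq_integral_of_forall_compl_eq_zero fun x hx => ?_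
      rw [image_eq_zero_of_notMem_tsupport fun h => hx (hs h), zero_smul]
    have e := (h₁.integral_eq φ hφ hc hs).symm.trans (h₂.integral_eq φ hφ hc hs)
    have e' := mul_left_cancel₀ (pow_ne_zero _ (by norm_num)) e
    rw [hset, hset] at e'
    simp only [Pi.sub_apply, smul_sub]
    rw [integral_sub (hint _ h₁.locallyIntegrableOn_deriv)
      (hint _ h₂.locallyIntegrableOn_deriv), e', sub_self]
  filter_upwards [key] with x hx hxΩ
  exact sub_eq_zero.1 (hx hxΩ)

open Classical in
/-- The weak derivative `D^γ u` on `Ω` (unique up to null subsets of the open set `Ω`);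
the value `0` if there is none is never used for functions of class `W^{k,p}_loc`, `|γ| ≤ k`. -/
def weakDeriv {N : ℕ} (Ω : Set (Eucl N)) (γ : MultiIndex N) (u : Eucl N → ℂ) : Eucl N → ℂ :=
  if h : ∃ g, HasWeakDeriv Ω γ u g then h.choose else 0

theorem HasWeakDeriv.hasWeakDeriv_weakDeriv {N : ℕ} {Ω : Set (Eucl N)} {γ : MultiIndex N}
    {u g : Eucl N → ℂ} (h : HasWeakDeriv Ω γ u g) :
    HasWeakDeriv Ω γ u (weakDeriv Ω γ u) := by
  have h' : ∃ g, HasWeakDeriv Ω γ u g := ⟨g, h⟩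
  rw [weakDeriv, dif_pos h']
  exact h'.choose_spec

/-! ### Sobolev spaces -/

/-- `u ∈ W^{k,p}(Ω)`: `u` and its weak derivatives of order at most `k` lie in `L^p(Ω)`. -/
def MemSobolev {N : ℕ} (k : ℕ) (p : ℝ≥0∞) (Ω : Set (Eucl N)) (u : Eucl N → ℂ) : Prop :=
  MemLp u p (volume.restrict Ω) ∧
    ∀ γ : MultiIndex N, γ.order ≤ k →
      ∃ g, HasWeakDeriv Ω γ u g ∧ MemLp g p (volume.restrict Ω)

/-- `u ∈ W^{k,p}_loc(Ω)`: `u` and its weak derivatives of order at most `k` are in `L^p(K)` for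
every compact subset `K` of `Ω`. -/
def MemSobolevLoc {N : ℕ} (k : ℕ) (p : ℝ≥0∞) (Ω : Set (Eucl N)) (u : Eucl N → ℂ) : Prop :=
  (∀ K ⊆ Ω, IsCompact K → MemLp u p (volume.restrict K)) ∧
    ∀ γ : MultiIndex N, γ.order ≤ k →
      ∃ g, HasWeakDeriv Ω γ u g ∧ ∀ K ⊆ Ω, IsCompact K → MemLp g p (volume.restrict K)

/-- `∑_{|γ| ≤ k} ‖w D^γ u‖_{L^p(Ω)}`, with values in `[0, ∞]`. -/
def weightedSobolevNorm {N : ℕ} (k : ℕ) (p : ℝ≥0∞) (Ω : Set (Eucl N)) (w : Eucl N → ℝ)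
    (u : Eucl N → ℂ) : ℝ≥0∞ :=
  ∑ γ ∈ multiIndices N k, eLpNorm (fun x => w x • weakDeriv Ω γ u x) p (volume.restrict Ω)

/-- `‖u‖_{W^{k,p}(Ω)} = ∑_{|γ| ≤ k} ‖D^γ u‖_{L^p(Ω)}`, with values in `[0, ∞]`. -/
def sobolevNorm {N : ℕ} (k : ℕ) (p : ℝ≥0∞) (Ω : Set (Eucl N)) (u : Eucl N → ℂ) : ℝ≥0∞ :=
  ∑ γ ∈ multiIndices N k, eLpNorm (weakDeriv Ω γ u) p (volume.restrict Ω)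

end WeightedSobolev

end

noncomputable section

namespace WeightedSobolev

/-! ### Iterated classical derivatives of smooth functions -/

/-! The engine is Hardy's inequality: up to a constant, the `L^P` norm of `δ^n u` is bounded by
those of `δ^(n+1) u` and `δ^(n+1) ∂_i u` (`exists_hardy`). Applied to `D^α u`, it trades one power
of `δ` for one more derivative. After `k - l` applications the weight is gone, and the orders `|α| ≤
l` are exactly those for which all derivatives needed still have order at most `k`
(`exists_weightedEnergy_weakDeriv_le`).

In one variable, with `t` the distance to the boundary, `f t` is compared with its values further
inside plus an integral of the derivative over `(t, r)`. Since one integrates away from the boundary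
and the exponents `n` are non-negative, no boundary condition is needed; the far values are averaged
over `(r/2, r)`, where the weight is bounded below, which produces the term in `u` itself
(`exists_lintegral_hardy_of_increment_le`).

To reach this from weak derivatives, increments along a fixed direction are written as integrals of
the weak directional derivative, for almost every starting point (`ae_sub_eq_integral_of_weak`, then
`HasWeakLineDeriv.ae_enorm_le` inside `Ω`). Near a boundary point, flattening the graph by a
measure-preserving shear gives coordinates in which the height is comparable to `δ`
(`exists_boundaryChart`), and Tonelli reduces to the one-dimensional inequality on the fibres.
Compactness of the boundary makes the constant uniform near it; away from it `δ` is bounded below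
and powers of `δ` may be added freely. -/

theorem contDiff_partialDeriv {N : ℕ} (i : Fin N) {φ : Eucl N → ℝ}
    (hφ : ContDiff ℝ (⊤ : ℕ∞) φ) : ContDiff ℝ (⊤ : ℕ∞) (partialDeriv i φ) := by
  have h : ContDiff ℝ (⊤ : ℕ∞) (fderiv ℝ φ) := hφ.fderiv_right (by simp)
  exact h.clm_apply contDiff_const

theorem contDiff_iterate_partialDeriv {N : ℕ} (i : Fin N) (n : ℕ) {φ : Eucl N → ℝ}
    (hφ : ContDiff ℝ (⊤ : ℕ∞) φ) : ContDiff ℝ (⊤ : ℕ∞) ((partialDeriv i)^[n] φ) := by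
  induction n with
  | zero => exact hφ
  | succ n ih => rw [Function.iterate_succ_apply']; exact contDiff_partialDeriv i ih

theorem partialDeriv_comm {N : ℕ} (i j : Fin N) {φ : Eucl N → ℝ}
    (hφ : ContDiff ℝ (⊤ : ℕ∞) φ) :
    partialDeriv i (partialDeriv j φ) = partialDeriv j (partialDeriv i φ) := by
  have h : ContDiff ℝ (⊤ : ℕ∞) (fderiv ℝ φ) := hφ.fderiv_right (by simp)
  have hd : Differentiable ℝ (fderiv ℝ φ) := h.differentiable (by simp)
  have key : ∀ (a b : Fin N) (x : Eucl N), partialDeriv a (partialDeriv b φ) x =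
      fderiv ℝ (fderiv ℝ φ) x (EuclideanSpace.single a 1) (EuclideanSpace.single b 1) := by
    intro a b x
    have : partialDeriv b φ = fun x => fderiv ℝ φ x (EuclideanSpace.single b 1) := rfl
    rw [partialDeriv, this, fderiv_clm_apply (hd x) (differentiableAt_const _)]
    simp
  funext x
  rw [key, key]
  have hs : IsSymmSndFDerivAt ℝ φ x :=
    (hφ.contDiffAt).isSymmSndFDerivAt
      (by simpa using (WithTop.coe_le_coe.2 (le_top : (2 : ℕ∞) ≤ ⊤)))
  exact hs _ _

theorem partialDeriv_iterate_comm {N : ℕ} (i j : Fin N) (n : ℕ) {φ : Eucl N → ℝ}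
    (hφ : ContDiff ℝ (⊤ : ℕ∞) φ) :
    (partialDeriv i)^[n] (partialDeriv j φ) = partialDeriv j ((partialDeriv i)^[n] φ) := by
  induction n with
  | zero => rfl
  | succ n ih =>
    rw [Function.iterate_succ_apply', ih,
      partialDeriv_comm _ _ (contDiff_iterate_partialDeriv i n hφ), Function.iterate_succ_apply']

theorem contDiff_foldr_partialDeriv {N : ℕ} (γ : MultiIndex N) (L : List (Fin N))
    {φ : Eucl N → ℝ} (hφ : ContDiff ℝ (⊤ : ℕ∞) φ) :
    ContDiff ℝ (⊤ : ℕ∞) (L.foldr (fun i f => (partialDeriv i)^[γ i] f) φ) := by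
  induction L with
  | nil => exact hφ
  | cons a L ih => exact contDiff_iterate_partialDeriv _ _ ih

theorem foldr_partialDeriv_comm {N : ℕ} (γ : MultiIndex N) (j : Fin N) (L : List (Fin N))
    {φ : Eucl N → ℝ} (hφ : ContDiff ℝ (⊤ : ℕ∞) φ) :
    L.foldr (fun i f => (partialDeriv i)^[γ i] f) (partialDeriv j φ) =
      partialDeriv j (L.foldr (fun i f => (partialDeriv i)^[γ i] f) φ) := by
  induction L with
  | nil => rfl
  | cons a L ih =>
    rw [List.foldr_cons, ih, partialDeriv_iterate_comm _ _ _ (contDiff_foldr_partialDeriv γ L hφ),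
      List.foldr_cons]

theorem foldr_add_single_of_notMem {N : ℕ} (γ : MultiIndex N) (j : Fin N) (L : List (Fin N))
    (hj : j ∉ L) (φ : Eucl N → ℝ) :
    L.foldr (fun i f => (partialDeriv i)^[(γ + Pi.single j 1 : MultiIndex N) i] f) φ =
      L.foldr (fun i f => (partialDeriv i)^[γ i] f) φ := by
  induction L with
  | nil => rfl
  | cons a L ih =>
    rw [List.mem_cons, not_or] at hj
    rw [List.foldr_cons, ih hj.2, List.foldr_cons]
    simp [Pi.single_eq_of_ne' hj.1]

theorem foldr_add_single_of_mem {N : ℕ} (γ : MultiIndex N) (j : Fin N) (L : List (Fin N))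
    (hL : L.Nodup) (hj : j ∈ L) {φ : Eucl N → ℝ} (hφ : ContDiff ℝ (⊤ : ℕ∞) φ) :
    L.foldr (fun i f => (partialDeriv i)^[(γ + Pi.single j 1 : MultiIndex N) i] f) φ =
      partialDeriv j (L.foldr (fun i f => (partialDeriv i)^[γ i] f) φ) := by
  induction L with
  | nil => simp at hj
  | cons a L ih =>
    rw [List.nodup_cons] at hL
    rcases eq_or_ne j a with rfl | hne
    · rw [List.foldr_cons, foldr_add_single_of_notMem _ _ _ hL.1, List.foldr_cons]
      simp only [Pi.add_apply, Pi.single_eq_same]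
      rw [Function.iterate_succ_apply']
    · have hjL : j ∈ L := (List.mem_cons.1 hj).resolve_left hne
      rw [List.foldr_cons, ih hL.2 hjL, List.foldr_cons, ← partialDeriv_iterate_comm _ _ _
        (contDiff_foldr_partialDeriv γ L hφ)]
      simp [Pi.single_eq_of_ne' hne]

/-- `multiDeriv` applies the partial derivatives in a fixed order, so the extra derivative appears
inside the fold; symmetry of second derivatives moves it to the innermost place, where it becomes
part of the test function. -/
theorem multiDeriv_add_single {N : ℕ} (γ : MultiIndex N) (j : Fin N)
    {φ : Eucl N → ℝ} (hφ : ContDiff ℝ (⊤ : ℕ∞) φ) :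
    multiDeriv (γ + Pi.single j 1) φ = multiDeriv γ (partialDeriv j φ) := by
  rw [multiDeriv, multiDeriv, foldr_partialDeriv_comm _ _ _ hφ,
    foldr_add_single_of_mem _ _ _ (List.nodup_finRange N) (List.mem_finRange j) hφ]

theorem multiDeriv_zero {N : ℕ} (φ : Eucl N → ℝ) : multiDeriv 0 φ = φ := by
  rw [multiDeriv]
  induction List.finRange N with
  | nil => rfl
  | cons a L ih => rw [List.foldr_cons, ih]; rfl

theorem multiDeriv_single {N : ℕ} (j : Fin N) {φ : Eucl N → ℝ} (hφ : ContDiff ℝ (⊤ : ℕ∞) φ) :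
    multiDeriv (Pi.single j 1) φ = partialDeriv j φ := by
  have h := multiDeriv_add_single 0 j hφ
  rwa [zero_add, multiDeriv_zero] at h

theorem order_add_single {N : ℕ} (γ : MultiIndex N) (j : Fin N) :
    (γ + Pi.single j 1 : MultiIndex N).order = γ.order + 1 := by
  simp [MultiIndex.order, Finset.sum_add_distrib]

theorem order_single {N : ℕ} (j : Fin N) :
    MultiIndex.order (Pi.single j 1 : MultiIndex N) = 1 := by
  simp [MultiIndex.order]

/-! ### Weak derivatives of weak derivatives -/

theorem tsupport_partialDeriv_subset {N : ℕ} (i : Fin N) (φ : Eucl N → ℝ) :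
    tsupport (partialDeriv i φ) ⊆ tsupport φ :=
  tsupport_fderiv_apply_subset ℝ _

theorem hasCompactSupport_partialDeriv {N : ℕ} (i : Fin N) {φ : Eucl N → ℝ}
    (hφ : HasCompactSupport φ) : HasCompactSupport (partialDeriv i φ) :=
  hφ.fderiv_apply ℝ _

theorem HasWeakDeriv.self {N : ℕ} {Ω : Set (Eucl N)} {u : Eucl N → ℂ}
    (hu : LocallyIntegrableOn u Ω) : HasWeakDeriv Ω 0 u u :=
  ⟨hu, hu, fun φ _ _ _ => by simp [multiDeriv_zero, MultiIndex.order]⟩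

/-- If `g = D^γ u` and `g' = D^{γ + e_i} u`, then `g' = ∂_i g`. -/
theorem HasWeakDeriv.of_add_single {N : ℕ} {Ω : Set (Eucl N)} {γ : MultiIndex N} {i : Fin N}
    {u g g' : Eucl N → ℂ} (h : HasWeakDeriv Ω γ u g)
    (h' : HasWeakDeriv Ω (γ + Pi.single i 1) u g') : HasWeakDeriv Ω (Pi.single i 1) g g' := by
  refine ⟨h.locallyIntegrableOn_deriv, h'.locallyIntegrableOn_deriv, fun φ hφ hc hs => ?_⟩
  -- Testing `D^γ u = g` with `∂_i φ` and `D^(γ+e_i) u = g'` with `φ` gives the same left side;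
  -- cancelling `(-1)^|γ|` leaves the integration by parts for `g` and `g'`.
  have e := h.integral_eq (partialDeriv i φ) (contDiff_partialDeriv i hφ)
    (hasCompactSupport_partialDeriv i hc) ((tsupport_partialDeriv_subset i φ).trans hs)
  have e' := h'.integral_eq φ hφ hc hs
  rw [multiDeriv_add_single γ i hφ, e, order_add_single, pow_succ, mul_assoc] at e'
  have e'' := mul_left_cancel₀ (pow_ne_zero _ (by norm_num)) e'
  rw [multiDeriv_single i hφ, order_single, pow_one, e'']

/-- Weak derivatives depend only on the almost everywhere classes on the domain. -/
theorem HasWeakDeriv.congr {N : ℕ} {Ω : Set (Eucl N)} {γ : MultiIndex N}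
    {u g u' g' : Eucl N → ℂ} (h : HasWeakDeriv Ω γ u g) (hu : u =ᵐ[volume.restrict Ω] u')
    (hg : g =ᵐ[volume.restrict Ω] g') : HasWeakDeriv Ω γ u' g' := by
  have hloc : ∀ f f' : Eucl N → ℂ, LocallyIntegrableOn f Ω → f =ᵐ[volume.restrict Ω] f' →
      LocallyIntegrableOn f' Ω := by
    intro f f' hf hff' x hx
    obtain ⟨s, hs, hi⟩ := hf x hx
    refine ⟨s ∩ Ω, Filter.inter_mem hs self_mem_nhdsWithin, ?_⟩
    exact (hi.mono_set inter_subset_left).congr_fun_ae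
      (ae_restrict_of_ae_restrict_of_subset inter_subset_right hff')
  refine ⟨hloc _ _ h.locallyIntegrableOn hu, hloc _ _ h.locallyIntegrableOn_deriv hg,
    fun φ hφ hc hs => ?_⟩
  have e := h.integral_eq φ hφ hc hs
  rw [integral_congr_ae (g := fun x => multiDeriv γ φ x • u' x)
    (hu.mono fun x hx => by simp only [hx]),
    integral_congr_ae (f := fun x => φ x • g x) (g := fun x => φ x • g' x)
    (hg.mono fun x hx => by simp only [hx])] at e
  exact e

/-! ### Weak derivatives and increments along lines -/

theorem integral_fderiv_sub_smul {N : ℕ} {φ : Eucl N → ℝ} (hφ : ContDiff ℝ (⊤ : ℕ∞) φ)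
    (e x : Eucl N) {t : ℝ} (ht : 0 ≤ t) :
    ∫ τ in Ioc 0 t, fderiv ℝ φ (x - τ • e) e = φ x - φ (x - t • e) := by
  have hd : ∀ τ : ℝ, HasDerivAt (fun τ : ℝ => -φ (x - τ • e)) (fderiv ℝ φ (x - τ • e) e) τ := by
    intro τ
    have h1 : HasDerivAt (fun τ : ℝ => x - τ • e) (-e) τ := by
      simpa using ((hasDerivAt_id τ).smul_const e).const_sub x
    have h2 := ((hφ.differentiable (by simp) (x - τ • e)).hasFDerivAt).comp_hasDerivAt τ h1
    exact h2.neg.congr_deriv (by simp)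
  have hc : Continuous fun τ : ℝ => fderiv ℝ φ (x - τ • e) e :=
    ((hφ.continuous_fderiv (by simp)).comp (by fun_prop : Continuous fun τ : ℝ => x - τ • e)).clm_apply
      continuous_const
  rw [← intervalIntegral.integral_of_le ht,
    intervalIntegral.integral_eq_sub_of_hasDerivAt (fun τ _ => hd τ) (hc.intervalIntegrable _ _)]
  simp; ring

/-- All slices are translates of `G` and so have the same `L^1` norm, while `ν` is finite; this
justifies Fubini for integrals along segments. -/
theorem integrable_prod_comp_add_smul {N : ℕ} {G : Eucl N → ℂ} (hGm : StronglyMeasurable G)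
    (hG : Integrable G) (e : Eucl N) (ν : Measure ℝ) [IsFiniteMeasure ν] :
    Integrable (fun z : Eucl N × ℝ => G (z.1 + z.2 • e)) (volume.prod ν) := by
  have hm : Measurable fun z : Eucl N × ℝ => z.1 + z.2 • e := by fun_prop
  have hfm : StronglyMeasurable fun z : Eucl N × ℝ => G (z.1 + z.2 • e) := hGm.comp_measurable hm
  rw [integrable_prod_iff' hfm.aestronglyMeasurable]
  refine ⟨Filter.Eventually.of_forall fun τ => hG.comp_add_right (τ • e), ?_⟩
  have : (fun τ : ℝ => ∫ x, ‖G (x + τ • e)‖) = fun _ => ∫ x, ‖G x‖ := by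
    funext τ
    exact integral_add_right_eq_self (fun x => ‖G x‖) (τ • e)
  simp only [this]
  exact integrable_const _

/-- If `G` is the weak derivative of `V` along `e` on the whole space, then increments of `V` along
`e` are integrals of `G`. -/
theorem ae_sub_eq_integral_of_weak {N : ℕ} {V G : Eucl N → ℂ} (hGm : StronglyMeasurable G)
    (hV : Integrable V) (hG : Integrable G) (e : Eucl N)
    (h : ∀ φ : Eucl N → ℝ, ContDiff ℝ (⊤ : ℕ∞) φ → HasCompactSupport φ →
      ∫ x, fderiv ℝ φ x e • V x = -∫ x, φ x • G x) {t : ℝ} (ht : 0 ≤ t) :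
    ∀ᵐ x, V (x + t • e) - V x = ∫ τ in Ioc 0 t, G (x + τ • e) := by
  set ν : Measure ℝ := volume.restrict (Ioc 0 t) with hν
  have hG2 := integrable_prod_comp_add_smul hGm hG e ν
  have hVt : Integrable fun x => V (x + t • e) := hV.comp_add_right (t • e)
  have hI : Integrable fun x => ∫ τ, G (x + τ • e) ∂ν := hG2.integral_prod_left
  have hW : Integrable fun x => V (x + t • e) - V x - ∫ τ, G (x + τ • e) ∂ν :=
    (hVt.sub hV).sub hI
  have key : ∀ᵐ x, V (x + t • e) - V x - ∫ τ, G (x + τ • e) ∂ν = 0 := by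
    apply ae_eq_zero_of_integral_contDiff_smul_eq_zero hW.locallyIntegrable
    intro φ hφ hc
    obtain ⟨B, hB⟩ := hc.exists_bound_of_continuous hφ.continuous
    have hDc : Continuous fun x => fderiv ℝ φ x e :=
      (hφ.continuous_fderiv (by simp)).clm_apply continuous_const
    obtain ⟨B', hB'⟩ := (hc.fderiv_apply ℝ e).exists_bound_of_continuous hDc
    have hsm : ∀ {α : Type} [MeasurableSpace α] {m : Measure α} {f : α → ℂ} {ψ : α → ℝ} {b : ℝ},
        Integrable f m → AEStronglyMeasurable ψ m → (∀ x, ‖ψ x‖ ≤ b) →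
        Integrable (fun x => ψ x • f x) m := fun hf hψ hb =>
      hf.smul_of_top_right (memLp_top_of_bound hψ _ (Filter.Eventually.of_forall hb))
    have hφm := hφ.continuous.aestronglyMeasurable (μ := (volume : Measure (Eucl N)))
    -- By Fubini the translation is moved onto the test function, the weak derivative is used for
    -- each fixed `τ`, and the fundamental theorem of calculus is applied only to the smooth `φ`.
    have e1 : ∫ x, φ x • ∫ τ, G (x + τ • e) ∂ν =
        -∫ x, (φ x - φ (x - t • e)) • V x := by
      calc ∫ x, φ x • ∫ τ, G (x + τ • e) ∂ν
          = ∫ x, ∫ τ, φ x • G (x + τ • e) ∂ν := by simp_rw [integral_smul]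
        _ = ∫ τ, (∫ x, φ x • G (x + τ • e)) ∂ν := by
            refine integral_integral_swap ?_
            exact hsm (ψ := fun z : Eucl N × ℝ => φ z.1) hG2
              (hφ.continuous.comp continuous_fst).aestronglyMeasurable fun z => hB z.1
        _ = ∫ τ, (-∫ x, fderiv ℝ φ (x - τ • e) e • V x) ∂ν := by
            congr 1
            funext τ
            have hψ : ContDiff ℝ (⊤ : ℕ∞) fun x => φ (x - τ • e) :=
              hφ.comp (contDiff_id.sub (contDiff_const (c := τ • e)))
            have hψc : HasCompactSupport fun x => φ (x - τ • e) :=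
              hc.comp_homeomorph (Homeomorph.subRight (τ • e))
            have hh := h _ hψ hψc
            have hf : ∀ x, fderiv ℝ (fun x => φ (x - τ • e)) x = fderiv ℝ φ (x - τ • e) :=
              
              fun x => fderiv_comp_sub _
            simp only [hf] at hh
            rw [hh, neg_neg, 
              ← integral_add_right_eq_self (fun x => φ (x - τ • e) • G x) (τ • e)]
            simp
        _ = -∫ x, ∫ τ, fderiv ℝ φ (x - τ • e) e • V x ∂ν := by
            rw [integral_neg, integral_integral_swap]
            refine hsm (ψ := fun z : ℝ × Eucl N => fderiv ℝ φ (z.2 - z.1 • e) e)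
              (f := fun z : ℝ × Eucl N => V z.2) (hV.comp_snd ν) ?_ fun z => hB' (z.2 - z.1 • e)
            exact (hDc.comp (by fun_prop : Continuous fun z : ℝ × Eucl N =>
              z.2 - z.1 • e)).aestronglyMeasurable
        _ = -∫ x, (φ x - φ (x - t • e)) • V x := by
            congr 2
            funext x
            rw [integral_smul_const, hν, integral_fderiv_sub_smul hφ e x ht]
    have e2 : ∫ x, φ x • V (x + t • e) = ∫ x, φ (x - t • e) • V x := by
      rw [← integral_add_right_eq_self (fun x => φ (x - t • e) • V x) (t • e)]
      simp
    have i1 := hsm hV hφm hB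
    have i2 : Integrable fun x => φ (x - t • e) • V x :=
      hsm hV (hφ.continuous.comp (by fun_prop : Continuous fun x : Eucl N =>
        x - t • e)).aestronglyMeasurable fun x => hB (x - t • e)
    have e3 : ∫ x, (φ x - φ (x - t • e)) • V x =
        (∫ x, φ x • V x) - ∫ x, φ (x - t • e) • V x := by
      simp_rw [sub_smul]
      exact integral_sub i1 i2
    simp_rw [smul_sub]
    have i3 : Integrable fun x => φ x • V (x + t • e) - φ x • V x := (hsm hVt hφm hB).sub i1
    rw [integral_sub i3 (hsm hI hφm hB), integral_sub (hsm hVt hφm hB) i1, e1, e2, e3]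
    ring
  filter_upwards [key] with x hx
  exact sub_eq_zero.1 hx

/-- `g` is the weak derivative of `u` in the direction `e` on `Ω`. -/
structure HasWeakLineDeriv {N : ℕ} (Ω : Set (Eucl N)) (e : Eucl N) (u g : Eucl N → ℂ) : Prop where
  locallyIntegrableOn : LocallyIntegrableOn u Ω
  locallyIntegrableOn_deriv : LocallyIntegrableOn g Ω
  integral_eq : ∀ φ : Eucl N → ℝ, ContDiff ℝ (⊤ : ℕ∞) φ → HasCompactSupport φ → tsupport φ ⊆ Ω →
    ∫ x in Ω, fderiv ℝ φ x e • u x = -∫ x in Ω, φ x • g x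

theorem integrable_smul_of_tsupport_subset {N : ℕ} {Ω : Set (Eucl N)}
    {g : Eucl N → ℂ} (hg : LocallyIntegrableOn g Ω) {φ : Eucl N → ℝ} (hφ : Continuous φ)
    (hc : HasCompactSupport φ) (hs : tsupport φ ⊆ Ω) : Integrable fun x => φ x • g x := by
  have hK : IntegrableOn g (tsupport φ) := hg.integrableOn_compact_subset hs hc
  refine (integrableOn_iff_integrable_of_support_subset ?_).1
    (hK.continuousOn_smul hφ.continuousOn hc)
  exact (Function.support_smul_subset_left φ g).trans (subset_tsupport φ)

theorem setIntegral_smul_eq_of_tsupport_subset {N : ℕ} {Ω : Set (Eucl N)} {φ : Eucl N → ℝ}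
    (hs : tsupport φ ⊆ Ω) (g : Eucl N → ℂ) : ∫ x in Ω, φ x • g x = ∫ x, φ x • g x := by
  refine setIntegral_eq_integral_of_forall_compl_eq_zero fun x hx => ?_
  rw [image_eq_zero_of_notMem_tsupport fun h => hx (hs h), zero_smul]

/-- Directional weak derivatives are linear combinations of the partial ones. -/
theorem hasWeakLineDeriv_sum {N : ℕ} {Ω : Set (Eucl N)} (e : Eucl N) {u : Eucl N → ℂ}
    {g : Fin N → Eucl N → ℂ} (hu : LocallyIntegrableOn u Ω)
    (h : ∀ i, HasWeakDeriv Ω (Pi.single i 1) u (g i)) :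
    HasWeakLineDeriv Ω e u fun x => ∑ i, e i • g i x := by
  have hg : ∀ i, LocallyIntegrableOn (fun x => e i • g i x) Ω := fun i =>
    (h i).locallyIntegrableOn_deriv.smul (e i)
  refine ⟨hu, ?_, fun φ hφ hc hs => ?_⟩
  · have : (fun x => ∑ i, e i • g i x) = ∑ i, fun x => e i • g i x := by
      funext x; simp
    rw [this]
    exact Finset.sum_induction _ (fun f => LocallyIntegrableOn f Ω) (fun _ _ => .add)
      (fun x _ => ⟨univ, Filter.univ_mem, integrableOn_zero⟩) fun i _ => hg i
  · have hD : ∀ x, fderiv ℝ φ x e = ∑ i, e i * partialDeriv i φ x := by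
      intro x
      conv_lhs => rw [← (EuclideanSpace.basisFun (Fin N) ℝ).sum_repr e]
      simp [partialDeriv]
    have hint : ∀ i, Integrable (fun x => (e i * partialDeriv i φ x) • u x) (volume.restrict Ω) := by
      intro i
      have := (integrable_smul_of_tsupport_subset hu (contDiff_partialDeriv i hφ).continuous
        (hasCompactSupport_partialDeriv i hc)
        ((tsupport_partialDeriv_subset i φ).trans hs)).smul (e i)
      simp_rw [mul_smul]
      exact this.integrableOn
    have hint' : ∀ i, Integrable (fun x => φ x • e i • g i x) (volume.restrict Ω) := fun i =>
      (integrable_smul_of_tsupport_subset (hg i) hφ.continuous hc hs).integrableOn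
    simp_rw [hD, Finset.sum_smul, Finset.smul_sum]
    rw [integral_finsetSum _ fun i _ => hint i, integral_finsetSum _ fun i _ => hint' i,
      ← Finset.sum_neg_distrib]
    refine Finset.sum_congr rfl fun i _ => ?_
    have hi := (h i).integral_eq φ hφ hc hs
    rw [multiDeriv_single i hφ, order_single, pow_one, neg_one_mul] at hi
    simp_rw [mul_smul, smul_comm (φ _) (e i)]
    rw [integral_smul, integral_smul, hi, smul_neg]

/-- Increments along `e` of a function cut off by a test function. -/
theorem HasWeakLineDeriv.ae_cutoff_sub_eq {N : ℕ} {Ω : Set (Eucl N)} {e : Eucl N}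
    {u g : Eucl N → ℂ} (h : HasWeakLineDeriv Ω e u g) (hum : StronglyMeasurable u)
    (hgm : StronglyMeasurable g) {χ : Eucl N → ℝ} (hχ : ContDiff ℝ (⊤ : ℕ∞) χ)
    (hχc : HasCompactSupport χ) (hχs : tsupport χ ⊆ Ω) {t : ℝ} (ht : 0 ≤ t) :
    ∀ᵐ x, χ (x + t • e) • u (x + t • e) - χ x • u x = ∫ τ in Ioc 0 t,
      (χ (x + τ • e) • g (x + τ • e) + fderiv ℝ χ (x + τ • e) e • u (x + τ • e)) := by
  have hDc : Continuous fun x => fderiv ℝ χ x e :=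
    (hχ.continuous_fderiv (by simp)).clm_apply continuous_const
  have hDs : tsupport (fun x => fderiv ℝ χ x e) ⊆ Ω :=
    (tsupport_fderiv_apply_subset ℝ e).trans hχs
  have i1 := integrable_smul_of_tsupport_subset h.locallyIntegrableOn hχ.continuous hχc hχs
  have i2 := integrable_smul_of_tsupport_subset h.locallyIntegrableOn_deriv hχ.continuous hχc hχs
  have i3 := integrable_smul_of_tsupport_subset h.locallyIntegrableOn hDc
    (hχc.fderiv_apply ℝ e) hDs
  refine ae_sub_eq_integral_of_weak (V := fun x => χ x • u x)
    (G := fun x => χ x • g x + fderiv ℝ χ x e • u x)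
    ((hχ.continuous.stronglyMeasurable.smul hgm).add (hDc.stronglyMeasurable.smul hum))
    i1 (i2.add i3) e (fun φ hφ hc => ?_) ht
  -- `φ χ` is supported in `Ω` even when `φ` is not, so the product rule shows that `χ u` has weak
  -- derivative `χ g + (∂_e χ) u` on the whole space.
  have hψ : ContDiff ℝ (⊤ : ℕ∞) fun x => φ x * χ x := hφ.mul hχ
  have hψc : HasCompactSupport fun x => φ x * χ x := hc.mul_right
  have hψs : tsupport (fun x => φ x * χ x) ⊆ Ω := tsupport_mul_subset_right.trans hχs
  have hw := h.integral_eq _ hψ hψc hψs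
  rw [setIntegral_smul_eq_of_tsupport_subset ((tsupport_fderiv_apply_subset ℝ e).trans hψs),
    setIntegral_smul_eq_of_tsupport_subset hψs] at hw
  have hD : ∀ x, fderiv ℝ (fun x => φ x * χ x) x e =
      φ x * fderiv ℝ χ x e + χ x * fderiv ℝ φ x e := by
    intro x
    rw [fderiv_fun_mul (hφ.differentiable (by simp) x) (hχ.differentiable (by simp) x)]
    simp
  simp_rw [hD, add_smul] at hw
  have j1 : Integrable fun x => (φ x * fderiv ℝ χ x e) • u x :=
    integrable_smul_of_tsupport_subset h.locallyIntegrableOn (hφ.continuous.mul hDc)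
      hc.mul_right (tsupport_mul_subset_right.trans hDs)
  have j2 : Integrable fun x => (χ x * fderiv ℝ φ x e) • u x :=
    integrable_smul_of_tsupport_subset h.locallyIntegrableOn (hχ.continuous.mul
      ((hφ.continuous_fderiv (by simp)).clm_apply continuous_const))
      hχc.mul_right (tsupport_mul_subset_left.trans hχs)
  have j3 : Integrable fun x => (φ x * χ x) • g x :=
    integrable_smul_of_tsupport_subset h.locallyIntegrableOn_deriv hψ.continuous hψc hψs
  rw [integral_add j1 j2] at hw
  simp_rw [smul_add, smul_smul]
  rw [integral_add j3 j1]
  simp_rw [mul_comm (fderiv ℝ φ _ e)]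
  linear_combination hw

/-- The cutoff is `1` near each point of `K`, not merely on `K`, so that its derivative vanishes
there too. -/
theorem exists_cutoff {N : ℕ} {Ω K : Set (Eucl N)} (hΩ : IsOpen Ω) (hK : IsCompact K)
    (hKΩ : K ⊆ Ω) : ∃ χ : Eucl N → ℝ, ContDiff ℝ (⊤ : ℕ∞) χ ∧ HasCompactSupport χ ∧
      tsupport χ ⊆ Ω ∧ ∀ x ∈ K, χ =ᶠ[nhds x] 1 := by
  obtain ⟨L, hL, hKL, hLΩ⟩ := exists_compact_between hK hΩ hKΩ
  obtain ⟨f, hf1, hf0, -⟩ := exists_contMDiffMap_one_nhds_of_subset_interior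
    (modelWithCornersSelf ℝ (Eucl N)) (n := ⊤) hK.isClosed hKL
  have hs : tsupport (f : Eucl N → ℝ) ⊆ L :=
    closure_minimal (fun x hx => by_contra fun h => hx (hf0 x h)) hL.isClosed
  refine ⟨f, f.contMDiff.contDiff, hL.of_isClosed_subset (isClosed_tsupport _) hs,
    hs.trans hLΩ, fun x hx => ?_⟩
  exact (Filter.eventually_iff_exists_mem.2 ⟨_, mem_nhdsSet_iff_forall.1 hf1 x hx, fun y hy => hy⟩)

/-- Increments along segments inside `Ω` are bounded by integrals of the weak derivative. -/
theorem HasWeakLineDeriv.ae_enorm_le {N : ℕ} {Ω : Set (Eucl N)} (hΩ : IsOpen Ω) {e : Eucl N}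
    {u g : Eucl N → ℂ} (h : HasWeakLineDeriv Ω e u g) (hum : StronglyMeasurable u)
    (hgm : StronglyMeasurable g) {t : ℝ} (ht : 0 ≤ t) :
    ∀ᵐ x, (∀ τ ∈ Icc 0 t, x + τ • e ∈ Ω) →
      ‖u x‖ₑ ≤ ‖u (x + t • e)‖ₑ + ∫⁻ τ in Ioc 0 t, ‖g (x + τ • e)‖ₑ := by
  have := hΩ.locallyCompactSpace
  -- The cutoff needed depends on the segment, hence on `x`. Taking it from a countable family
  -- attached to an exhaustion leaves a single null set; each compact segment in `Ω` lies in some `K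
  -- n`.
  let K : CompactExhaustion Ω := default
  have hKc : ∀ n, IsCompact (Subtype.val '' K n) := fun n =>
    (K.isCompact n).image continuous_subtype_val
  have hKΩ : ∀ n, Subtype.val '' K n ⊆ Ω := fun n => by
    rintro _ ⟨y, -, rfl⟩; exact y.2
  choose χ h1 h2 h3 h4 using fun n => exists_cutoff hΩ (hKc n) (hKΩ n)
  filter_upwards [ae_all_iff.2 fun n => h.ae_cutoff_sub_eq hum hgm (h1 n) (h2 n) (h3 n) ht]
    with x hx hseg
  have hS : IsCompact ((fun τ : ℝ => x + τ • e) '' Icc 0 t) :=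
    isCompact_Icc.image (by fun_prop)
  have hSΩ : (fun τ : ℝ => x + τ • e) '' Icc 0 t ⊆ Ω := by
    rintro _ ⟨τ, hτ, rfl⟩; exact hseg τ hτ
  have hS' : IsCompact (Subtype.val ⁻¹' ((fun τ : ℝ => x + τ • e) '' Icc 0 t) : Set Ω) := by
    rw [Subtype.isCompact_iff, Subtype.image_preimage_coe, inter_eq_self_of_subset_right hSΩ]
    exact hS
  obtain ⟨n, hn⟩ := K.exists_superset_of_isCompact hS'
  have hmem : ∀ τ ∈ Icc 0 t, x + τ • e ∈ Subtype.val '' K n := fun τ hτ =>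
    ⟨⟨_, hseg τ hτ⟩, hn ⟨τ, hτ, rfl⟩, rfl⟩
  have e1 : ∀ τ ∈ Icc 0 t, χ n (x + τ • e) = 1 := fun τ hτ => (h4 n _ (hmem τ hτ)).self_of_nhds
  have e2 : ∀ τ ∈ Icc 0 t, fderiv ℝ (χ n) (x + τ • e) = 0 := fun τ hτ => by
    rw [(h4 n _ (hmem τ hτ)).fderiv_eq]
    exact fderiv_const_apply 1
  have hxn := hx n
  have e0 := e1 0 ⟨le_rfl, ht⟩
  rw [zero_smul, add_zero] at e0
  rw [e1 t ⟨ht, le_rfl⟩, e0, one_smul, one_smul, setIntegral_congr_fun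
    (g := fun τ => g (x + τ • e)) measurableSet_Ioc fun τ hτ => by
      simp [e1 τ (Ioc_subset_Icc_self hτ), e2 τ (Ioc_subset_Icc_self hτ)]] at hxn
  have hu : u x = u (x + t • e) - ∫ τ in Ioc 0 t, g (x + τ • e) := by rw [← hxn]; ring
  rw [hu]
  exact (enorm_sub_le).trans (add_le_add_right (enorm_integral_le_lintegral_enorm _) _)

/-! ### Hardy's inequality on an interval -/

theorem lintegral_Ioi_rpow {a t : ℝ} (ha : a < -1) (ht : 0 < t) :
    ∫⁻ τ in Ioi t, ENNReal.ofReal τ ^ a = ENNReal.ofReal (t ^ (a + 1) / (-(a + 1))) := by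
  have hi : Integrable (fun τ : ℝ => τ ^ a) (volume.restrict (Ioi t)) :=
    integrableOn_Ioi_rpow_of_lt ha ht
  have h0 : ∀ᵐ τ : ℝ ∂volume.restrict (Ioi t), 0 ≤ τ ^ a := by
    filter_upwards [ae_restrict_mem measurableSet_Ioi] with τ hτ
    exact Real.rpow_nonneg (ht.trans hτ).le _
  rw [div_neg, ← neg_div, ← integral_Ioi_rpow_of_lt ha ht,
    ofReal_integral_eq_lintegral_ofReal hi h0]
  refine setLIntegral_congr_fun measurableSet_Ioi fun τ hτ => ?_
  exact ENNReal.ofReal_rpow_of_pos (ht.trans hτ)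

theorem lintegral_Ioo_rpow_neg_half {b : ℝ} (hb : 0 < b) :
    ∫⁻ t in Ioo 0 b, ENNReal.ofReal t ^ (-(1 / 2) : ℝ) = 2 * ENNReal.ofReal b ^ (1 / 2 : ℝ) := by
  have hii : IntervalIntegrable (fun τ : ℝ => τ ^ (-(1 / 2) : ℝ)) volume 0 b :=
    intervalIntegral.intervalIntegrable_rpow' (by norm_num)
  have hi : Integrable (fun τ : ℝ => τ ^ (-(1 / 2) : ℝ)) (volume.restrict (Ioc 0 b)) :=
    (intervalIntegrable_iff_integrableOn_Ioc_of_le hb.le).1 hii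
  have h0 : ∀ᵐ τ : ℝ ∂volume.restrict (Ioc 0 b), 0 ≤ τ ^ (-(1 / 2) : ℝ) := by
    filter_upwards [ae_restrict_mem measurableSet_Ioc] with τ hτ
    exact Real.rpow_nonneg hτ.1.le _
  have hval : ∫ τ in Ioc 0 b, τ ^ (-(1 / 2) : ℝ) = 2 * b ^ (1 / 2 : ℝ) := by
    rw [← intervalIntegral.integral_of_le hb.le, integral_rpow (Or.inl (by norm_num))]
    norm_num
    ring
  rw [setLIntegral_congr (Ioo_ae_eq_Ioc (μ := volume) (a := (0 : ℝ)) (b := b)),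
    ENNReal.ofReal_rpow_of_pos hb, ← ENNReal.ofReal_ofNat 2, ← ENNReal.ofReal_mul (by norm_num),
    ← hval, ofReal_integral_eq_lintegral_ofReal hi h0]
  refine setLIntegral_congr_fun measurableSet_Ioc fun τ hτ => ?_
  exact ENNReal.ofReal_rpow_of_pos hτ.1

/-- The pointwise estimate behind Hardy's inequality. -/
theorem lintegral_Ioo_rpow_le {P : ℝ} (hP : 1 < P) {f : ℝ → ℝ≥0∞} (hf : Measurable f) {r t : ℝ}
    (ht : 0 < t) :
    (∫⁻ τ in Ioo t r, f τ) ^ P ≤ ENNReal.ofReal ((2 * (P - 1)) ^ (P - 1)) *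
      (ENNReal.ofReal t ^ (-(1 / 2) : ℝ) *
        ∫⁻ τ in Ioo t r, f τ ^ P * ENNReal.ofReal τ ^ (P - 1 / 2)) := by
  have hP0 : 0 < P := by linarith
  have hP1 : 0 < P - 1 := by linarith
  set Q := P.conjExponent with hQ
  have hPQ : P.HolderConjugate Q := Real.HolderConjugate.conjExponent hP
  have hQv : Q = P / (P - 1) := rfl
  -- The Hölder weight `τ^β` has `β Q > 1`, so `τ^(-β Q)` is integrable on `(t, ∞)`, and the
  -- resulting power of `t` is `t^(-1/2)`, still integrable at `0`.
  set β : ℝ := 1 - 1 / (2 * P) with hβ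
  have hβP : β * P = P - 1 / 2 := by rw [hβ]; field_simp
  have hβQ : -β * Q = -1 - 1 / (2 * (P - 1)) := by
    rw [hβ, hQv]; field_simp; ring
  have hpos : ∀ τ ∈ Ioo t r, (0 : ℝ) < τ := fun τ hτ => ht.trans hτ.1
  have h1 : ∫⁻ τ in Ioo t r, f τ =
      ∫⁻ τ in Ioo t r, ((fun τ => f τ * ENNReal.ofReal τ ^ β) *
        fun τ => ENNReal.ofReal τ ^ (-β)) τ := by
    refine setLIntegral_congr_fun measurableSet_Ioo fun τ hτ => ?_
    have hτ0 : ENNReal.ofReal τ ≠ 0 := by simpa using hpos τ hτ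
    simp only [Pi.mul_apply]
    rw [mul_assoc, ← ENNReal.rpow_add _ _ hτ0 ENNReal.ofReal_ne_top, add_neg_cancel,
      ENNReal.rpow_zero, mul_one]
  have h2 : ∫⁻ τ in Ioo t r, (ENNReal.ofReal τ ^ (-β)) ^ Q ≤
      ENNReal.ofReal (2 * (P - 1) * t ^ (-(1 / (2 * (P - 1))))) := by
    calc ∫⁻ τ in Ioo t r, (ENNReal.ofReal τ ^ (-β)) ^ Q
        ≤ ∫⁻ τ in Ioi t, (ENNReal.ofReal τ ^ (-β)) ^ Q :=
          lintegral_mono_set Ioo_subset_Ioi_self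
      _ = ∫⁻ τ in Ioi t, ENNReal.ofReal τ ^ (-1 - 1 / (2 * (P - 1))) := by
          simp_rw [← ENNReal.rpow_mul, hβQ]
      _ = _ := by
          rw [lintegral_Ioi_rpow (by have : 0 < 1 / (2 * (P - 1)) := by positivity
                                     linarith) ht]
          congr 1
          rw [show -1 - 1 / (2 * (P - 1)) + 1 = -(1 / (2 * (P - 1))) by ring]
          field_simp
  have h3 : ∀ τ, (f τ * ENNReal.ofReal τ ^ β) ^ P = f τ ^ P * ENNReal.ofReal τ ^ (P - 1 / 2) := by
    intro τ
    rw [ENNReal.mul_rpow_of_nonneg _ _ hP0.le, ← ENNReal.rpow_mul, hβP]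
  have h4 := ENNReal.lintegral_mul_le_Lp_mul_Lq (volume.restrict (Ioo t r)) hPQ
    (f := fun τ => f τ * ENNReal.ofReal τ ^ β) (g := fun τ => ENNReal.ofReal τ ^ (-β))
    (by fun_prop) (by fun_prop)
  rw [← h1] at h4
  simp_rw [h3] at h4
  calc (∫⁻ τ in Ioo t r, f τ) ^ P
      ≤ ((∫⁻ τ in Ioo t r, f τ ^ P * ENNReal.ofReal τ ^ (P - 1 / 2)) ^ (1 / P) *
          ENNReal.ofReal (2 * (P - 1) * t ^ (-(1 / (2 * (P - 1))))) ^ (1 / Q)) ^ P := by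
        have hQ0 : 0 ≤ 1 / Q := by have := hPQ.symm.pos; positivity
        gcongr
        exact h4.trans (mul_le_mul_right (ENNReal.rpow_le_rpow h2 hQ0) _)
    _ = _ := by
        rw [ENNReal.mul_rpow_of_nonneg _ _ hP0.le, ← ENNReal.rpow_mul, ← ENNReal.rpow_mul,
          one_div_mul_cancel hP0.ne', ENNReal.rpow_one,
          show 1 / Q * P = P - 1 by rw [hQv]; field_simp,
          ENNReal.ofReal_rpow_of_pos (by positivity),
          Real.mul_rpow (by positivity) (by positivity), ← Real.rpow_mul ht.le,
          show -(1 / (2 * (P - 1))) * (P - 1) = -(1 / 2) by field_simp,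
          ENNReal.ofReal_mul (by positivity), ENNReal.ofReal_rpow_of_pos ht]
        ring

/-- Hardy's inequality for `t ↦ ∫_t^r f`. -/
theorem lintegral_hardy {P : ℝ} (hP : 1 < P) {f : ℝ → ℝ≥0∞} (hf : Measurable f) (r : ℝ) :
    ∫⁻ t in Ioo 0 r, (∫⁻ τ in Ioo t r, f τ) ^ P ≤
      ENNReal.ofReal ((2 * (P - 1)) ^ (P - 1)) * 2 *
        ∫⁻ t in Ioo 0 r, (ENNReal.ofReal t * f t) ^ P := by
  have hP0 : 0 < P := by linarith
  set c := ENNReal.ofReal ((2 * (P - 1)) ^ (P - 1)) with hc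
  set F : ℝ → ℝ≥0∞ := fun τ => f τ ^ P * ENNReal.ofReal τ ^ (P - 1 / 2) with hF
  have hFm : Measurable F := by fun_prop
  have hmeas : MeasurableSet {z : ℝ × ℝ | z.1 < z.2} := measurableSet_lt measurable_fst measurable_snd
  have hK : Measurable (Function.uncurry fun t τ : ℝ => ENNReal.ofReal t ^ (-(1 / 2) : ℝ) *
      {z : ℝ × ℝ | z.1 < z.2}.indicator (fun z => F z.2) (t, τ)) := by
    refine Measurable.mul (by fun_prop) ?_
    exact (hFm.comp measurable_snd).indicator hmeas
  calc ∫⁻ t in Ioo 0 r, (∫⁻ τ in Ioo t r, f τ) ^ P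
      ≤ ∫⁻ t in Ioo 0 r, c * (ENNReal.ofReal t ^ (-(1 / 2) : ℝ) * ∫⁻ τ in Ioo t r, F τ) :=
        setLIntegral_mono' measurableSet_Ioo fun t ht => lintegral_Ioo_rpow_le hP hf ht.1
    _ = c * ∫⁻ t in Ioo 0 r, ENNReal.ofReal t ^ (-(1 / 2) : ℝ) * ∫⁻ τ in Ioo t r, F τ :=
        lintegral_const_mul' _ _ ENNReal.ofReal_ne_top
    _ = c * ∫⁻ t in Ioo 0 r, ∫⁻ τ in Ioo 0 r, ENNReal.ofReal t ^ (-(1 / 2) : ℝ) *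
          {z : ℝ × ℝ | z.1 < z.2}.indicator (fun z => F z.2) (t, τ) := by
        congr 1
        refine setLIntegral_congr_fun measurableSet_Ioo fun t ht => ?_
        rw [lintegral_const_mul' _ _ (by
          rw [ENNReal.ofReal_rpow_of_pos ht.1]; exact ENNReal.ofReal_ne_top)]
        congr 1
        rw [← lintegral_indicator measurableSet_Ioo, ← lintegral_indicator measurableSet_Ioo]
        congr 1
        funext τ
        simp only [indicator, mem_Ioo, mem_ofPred_eq]
        have := ht.1
        split_ifs <;> first | rfl | (exfalso; grind)
    -- After exchanging the integrals, `t^(-1/2)` integrated over `(0, τ)` gives `2 τ^(1/2)`, which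
    -- completes the weight `τ^(P - 1/2)` to `τ^P`.
    _ = c * ∫⁻ τ in Ioo 0 r, ∫⁻ t in Ioo 0 r, ENNReal.ofReal t ^ (-(1 / 2) : ℝ) *
          {z : ℝ × ℝ | z.1 < z.2}.indicator (fun z => F z.2) (t, τ) := by
        rw [lintegral_lintegral_swap hK.aemeasurable]
    _ ≤ c * ∫⁻ τ in Ioo 0 r, 2 * (ENNReal.ofReal τ * f τ) ^ P := by
        refine mul_le_mul_right (setLIntegral_mono' measurableSet_Ioo fun τ hτ => ?_) _
        have hτ0 : ENNReal.ofReal τ ≠ 0 := by simpa using hτ.1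
        calc ∫⁻ t in Ioo 0 r, ENNReal.ofReal t ^ (-(1 / 2) : ℝ) *
              {z : ℝ × ℝ | z.1 < z.2}.indicator (fun z => F z.2) (t, τ)
            ≤ ∫⁻ t in Ioo 0 τ, ENNReal.ofReal t ^ (-(1 / 2) : ℝ) * F τ := by
              rw [← lintegral_indicator measurableSet_Ioo, ← lintegral_indicator measurableSet_Ioo]
              refine lintegral_mono fun t => ?_
              simp only [indicator, mem_Ioo, mem_ofPred_eq]
              split_ifs <;> first | simp; done | (exfalso; grind)
          _ = 2 * ENNReal.ofReal τ ^ (1 / 2 : ℝ) * F τ := by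
              rw [lintegral_mul_const _ (by fun_prop), lintegral_Ioo_rpow_neg_half hτ.1]
          _ = 2 * (ENNReal.ofReal τ * f τ) ^ P := by
              rw [hF, ENNReal.mul_rpow_of_nonneg _ _ hP0.le]
              simp only
              rw [show P = 1 / 2 + (P - 1 / 2) by ring,
                ENNReal.rpow_add (1 / 2) (P - 1 / 2) hτ0 ENNReal.ofReal_ne_top]
              ring_nf
      _ = c * 2 * ∫⁻ t in Ioo 0 r, (ENNReal.ofReal t * f t) ^ P := by
        rw [lintegral_const_mul' _ _ (by simp), mul_assoc]


theorem lintegral_rpow_le_of_Ioo {P : ℝ} (hP : 1 < P) {F : ℝ → ℝ≥0∞} (hF : Measurable F) (r : ℝ) :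
    (∫⁻ t in Ioo 0 r, F t) ^ P ≤ (∫⁻ t in Ioo 0 r, F t ^ P) * ENNReal.ofReal r ^ (P - 1) := by
  have hP0 : 0 < P := by linarith
  have hP1 : 0 < P - 1 := by linarith
  have hPQ : P.HolderConjugate P.conjExponent := Real.HolderConjugate.conjExponent hP
  have h := ENNReal.lintegral_mul_le_Lp_mul_Lq (volume.restrict (Ioo 0 r)) hPQ (f := F)
    (g := fun _ => 1) hF.aemeasurable aemeasurable_const
  simp only [Pi.mul_apply, mul_one, ENNReal.one_rpow, lintegral_const, one_mul,
    Measure.restrict_apply_univ, Real.volume_Ioo, sub_zero] at h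
  refine (ENNReal.rpow_le_rpow h hP0.le).trans_eq ?_
  rw [ENNReal.mul_rpow_of_nonneg _ _ hP0.le, ← ENNReal.rpow_mul, ← ENNReal.rpow_mul,
    one_div_mul_cancel hP0.ne', ENNReal.rpow_one,
    show 1 / P.conjExponent * P = P - 1 by rw [Real.conjExponent]; field_simp]

theorem lintegral_Ioo_comp_add {f : ℝ → ℝ≥0∞} (a b t : ℝ) :
    ∫⁻ τ in Ioo (a - t) (b - t), f (t + τ) = ∫⁻ τ in Ioo a b, f τ := by
  have h := (measurePreserving_add_left (volume : Measure ℝ) t).setLIntegral_comp_preimage_emb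
    (measurableEmbedding_addLeft t) f (Ioo a b)
  rwa [preimage_const_add_Ioo] at h

theorem lintegral_Ioc_comp_add_le {g : ℝ → ℝ≥0∞} {r t τ : ℝ} (h : t + τ < r) :
    ∫⁻ σ in Ioc 0 τ, g (t + σ) ≤ ∫⁻ σ in Ioo t r, g σ := by
  have := (lintegral_Ioo_comp_add (f := g) t r t).symm
  rw [this]
  exact lintegral_mono_set fun σ hσ => ⟨by linarith [hσ.1], by linarith [hσ.2]⟩

/-- The pointwise estimate in the lower half of the interval. -/
theorem le_average_add_lintegral {f g : ℝ → ℝ≥0∞} {r t : ℝ} (hr : 0 < r)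
    (ht0 : 0 < t) (ht : t < r / 2)
    (h : ∀ᵐ τ : ℝ, 0 < t → 0 < τ → t + τ < r → f t ≤ f (t + τ) + ∫⁻ σ in Ioc 0 τ, g (t + σ)) :
    f t ≤ ENNReal.ofReal (2 / r) * (∫⁻ τ in Ioo (r / 2) r, f τ) + ∫⁻ σ in Ioo t r, g σ := by
  set J := ∫⁻ σ in Ioo t r, g σ with hJ
  have hvol : volume (Ioo (r / 2 - t) (r - t)) = ENNReal.ofReal (r / 2) := by
    rw [Real.volume_Ioo]; congr 1; ring
  have hone : ENNReal.ofReal (2 / r) * ENNReal.ofReal (r / 2) = 1 := by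
    rw [← ENNReal.ofReal_mul (by positivity)]; field_simp; simp
  -- Average over `τ ∈ (r/2 - t, r - t)`: the endpoint `t + τ` then sweeps `(r/2, r)`, and `J`
  -- bounds the increment for every such `τ`.
  have key : f t * ENNReal.ofReal (r / 2) ≤
      (∫⁻ τ in Ioo (r / 2) r, f τ) + J * ENNReal.ofReal (r / 2) := by
    calc f t * ENNReal.ofReal (r / 2) = ∫⁻ _ in Ioo (r / 2 - t) (r - t), f t := by
          rw [lintegral_const, Measure.restrict_apply_univ, hvol]
      _ ≤ ∫⁻ τ in Ioo (r / 2 - t) (r - t), (f (t + τ) + J) := by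
          refine lintegral_mono_ae ?_
          filter_upwards [ae_restrict_mem measurableSet_Ioo, ae_restrict_of_ae h] with τ hτ hh
          have htr : t + τ < r := by linarith [hτ.2]
          refine (hh ht0 (by linarith [hτ.1]) htr).trans ?_
          gcongr
          exact lintegral_Ioc_comp_add_le htr
      _ = (∫⁻ τ in Ioo (r / 2) r, f τ) + J * ENNReal.ofReal (r / 2) := by
          rw [lintegral_add_right _ measurable_const, lintegral_Ioo_comp_add, lintegral_const,
            Measure.restrict_apply_univ, hvol]
  calc f t = ENNReal.ofReal (2 / r) * (f t * ENNReal.ofReal (r / 2)) := by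
        rw [mul_left_comm, hone, mul_one]
    _ ≤ ENNReal.ofReal (2 / r) * ((∫⁻ τ in Ioo (r / 2) r, f τ) + J * ENNReal.ofReal (r / 2)) := by
        gcongr
    _ = _ := by rw [mul_add, mul_left_comm _ J, hone, mul_one]

/-- The pointwise estimate for functions whose increments are controlled by an integral. -/
theorem pow_mul_le_of_increment_le (n : ℕ) {f g : ℝ → ℝ≥0∞} {r t : ℝ}
    (ht : t ∈ Ioo 0 r)
    (h : ∀ᵐ τ : ℝ, 0 < t → 0 < τ → t + τ < r → f t ≤ f (t + τ) + ∫⁻ σ in Ioc 0 τ, g (t + σ)) :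
    ENNReal.ofReal t ^ n * f t ≤
      ENNReal.ofReal (2 / r) * (ENNReal.ofReal t ^ (n + 1) * f t) +
      ENNReal.ofReal r ^ n * ENNReal.ofReal (2 / r) ^ (n + 2) *
        (∫⁻ τ in Ioo 0 r, ENNReal.ofReal τ ^ (n + 1) * f τ) +
      ∫⁻ τ in Ioo t r, ENNReal.ofReal τ ^ n * g τ := by
  have hr : 0 < r := ht.1.trans ht.2
  set a := ENNReal.ofReal (2 / r) with ha
  have hge : ∀ τ : ℝ, r / 2 ≤ τ → 1 ≤ a * ENNReal.ofReal τ := by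
    intro τ hτ
    rw [ha, ← ENNReal.ofReal_mul (by positivity), ENNReal.one_le_ofReal, div_mul_eq_mul_div,
      one_le_div hr]
    linarith
  -- In the upper half, `(2/r) t ≥ 1` supplies the missing power of `t` directly. In the lower half
  -- the averaged estimate is used: one factor `2/r` comes from the average and `n + 1` from
  -- inserting the weight on `(r/2, r)`.
  rcases le_or_gt (r / 2) t with hrt | hrt
  · refine le_trans ?_ (le_self_add.trans le_self_add)
    calc ENNReal.ofReal t ^ n * f t ≤ (a * ENNReal.ofReal t) * (ENNReal.ofReal t ^ n * f t) :=
          le_mul_of_one_le_left (zero_le) (hge t hrt)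
      _ = _ := by ring
  · have h1 := le_average_add_lintegral hr ht.1 hrt h
    have h2 : ∫⁻ τ in Ioo (r / 2) r, f τ ≤
        a ^ (n + 1) * ∫⁻ τ in Ioo 0 r, ENNReal.ofReal τ ^ (n + 1) * f τ := by
      rw [← lintegral_const_mul' _ _ (by simp [ha])]
      refine le_trans (setLIntegral_mono' measurableSet_Ioo fun τ hτ => ?_)
        (lintegral_mono_set (Ioo_subset_Ioo_left (by linarith)))
      rw [← mul_assoc, ← mul_pow]
      exact le_mul_of_one_le_left (zero_le) (one_le_pow_of_one_le' (hge τ hτ.1.le) _)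
    have h3 : ENNReal.ofReal t ^ n * ∫⁻ σ in Ioo t r, g σ ≤
        ∫⁻ τ in Ioo t r, ENNReal.ofReal τ ^ n * g τ := by
      rw [← lintegral_const_mul' _ _ (by simp)]
      refine setLIntegral_mono' measurableSet_Ioo fun τ hτ => ?_
      have := hτ.1.le
      gcongr
    have h4 : ENNReal.ofReal t ^ n ≤ ENNReal.ofReal r ^ n := by
      have := ht.2.le
      gcongr
    rw [add_assoc]
    refine le_trans ?_ le_add_self
    calc ENNReal.ofReal t ^ n * f t
        ≤ ENNReal.ofReal t ^ n * (a * (∫⁻ τ in Ioo (r / 2) r, f τ) + ∫⁻ σ in Ioo t r, g σ) := by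
          gcongr
      _ = ENNReal.ofReal t ^ n * (a * (∫⁻ τ in Ioo (r / 2) r, f τ)) +
          ENNReal.ofReal t ^ n * ∫⁻ σ in Ioo t r, g σ := mul_add _ _ _
      _ ≤ ENNReal.ofReal r ^ n *
            (a * (a ^ (n + 1) * ∫⁻ τ in Ioo 0 r, ENNReal.ofReal τ ^ (n + 1) * f τ)) +
          ∫⁻ τ in Ioo t r, ENNReal.ofReal τ ^ n * g τ := by
          gcongr
      _ = _ := by ring

/-- The pointwise bound is raised to the power `P` and integrated. Its integral term is handled by
Hardy's inequality for `τ^n g`, which supplies the extra factor `τ`; the other two terms involve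
only `t^(n+1) f`. -/
theorem exists_lintegral_hardy_of_increment_le {P : ℝ} (hP : 1 < P) (n : ℕ) (r : ℝ) :
    ∃ C : ℝ≥0∞, C ≠ ∞ ∧ ∀ f g : ℝ → ℝ≥0∞, Measurable f → Measurable g →
      (∀ᵐ t : ℝ, ∀ᵐ τ : ℝ, 0 < t → 0 < τ → t + τ < r →
        f t ≤ f (t + τ) + ∫⁻ σ in Ioc 0 τ, g (t + σ)) →
      ∫⁻ t in Ioo 0 r, (ENNReal.ofReal t ^ n * f t) ^ P ≤
        C * ((∫⁻ t in Ioo 0 r, (ENNReal.ofReal t ^ (n + 1) * f t) ^ P) +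
          ∫⁻ t in Ioo 0 r, (ENNReal.ofReal t ^ (n + 1) * g t) ^ P) := by
  have hP0 : 0 < P := by linarith
  set a := ENNReal.ofReal (2 / r) with ha
  set b := ENNReal.ofReal r ^ n * a ^ (n + 2) with hb
  set c := ENNReal.ofReal ((2 * (P - 1)) ^ (P - 1)) * 2 with hc
  set K : ℝ≥0∞ := 2 ^ (P - 1) with hK
  set ρ := ENNReal.ofReal r with hρ
  have hKt : K ≠ ∞ := ENNReal.rpow_ne_top_of_nonneg (by linarith) (by simp)
  have hat : a ^ P ≠ ∞ := ENNReal.rpow_ne_top_of_nonneg hP0.le (by simp [ha])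
  have hbt : b ^ P ≠ ∞ := ENNReal.rpow_ne_top_of_nonneg hP0.le (by
    rw [hb, ha]; finiteness)
  have hρt : ρ ^ (P - 1) ≠ ∞ := ENNReal.rpow_ne_top_of_nonneg (by linarith) (by simp [hρ])
  have hct : c ≠ ∞ := by simp [hc, ENNReal.mul_eq_top]
  -- Each splitting of a `P`-th power of a sum costs a factor `K`. In the middle term `ρ^(P-1)`
  -- comes from Hölder applied to `I`, and the last `ρ` from integrating a constant over `(0, r)`.
  refine ⟨K * K * a ^ P + K * K * (b ^ P * ρ ^ (P - 1) * ρ) + K * c, ?_, ?_⟩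
  · have hρ' : ρ ≠ ∞ := ENNReal.ofReal_ne_top
    finiteness
  intro f g hf hg h
  set A := ∫⁻ t in Ioo 0 r, (ENNReal.ofReal t ^ (n + 1) * f t) ^ P with hA
  set B := ∫⁻ t in Ioo 0 r, (ENNReal.ofReal t ^ (n + 1) * g t) ^ P with hB
  set I := ∫⁻ τ in Ioo 0 r, ENNReal.ofReal τ ^ (n + 1) * f τ with hI
  set J := fun t : ℝ => ∫⁻ τ in Ioo t r, ENNReal.ofReal τ ^ n * g τ with hJ
  have hIP : I ^ P ≤ A * ρ ^ (P - 1) :=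
    lintegral_rpow_le_of_Ioo hP (F := fun τ => ENNReal.ofReal τ ^ (n + 1) * f τ) (by fun_prop) r
  have hJP : ∫⁻ t in Ioo 0 r, J t ^ P ≤ c * B := by
    refine (lintegral_hardy hP (f := fun τ => ENNReal.ofReal τ ^ n * g τ) (by fun_prop) r).trans_eq ?_
    simp only [hB, ← mul_assoc, ← pow_succ', hc]
  calc ∫⁻ t in Ioo 0 r, (ENNReal.ofReal t ^ n * f t) ^ P
      ≤ ∫⁻ t in Ioo 0 r, (K * K * a ^ P * (ENNReal.ofReal t ^ (n + 1) * f t) ^ P +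
          K * K * (b * I) ^ P + K * J t ^ P) := by
        refine lintegral_mono_ae ?_
        filter_upwards [ae_restrict_mem measurableSet_Ioo, ae_restrict_of_ae h] with t ht hh
        have h1 := pow_mul_le_of_increment_le n ht hh
        calc (ENNReal.ofReal t ^ n * f t) ^ P
            ≤ (a * (ENNReal.ofReal t ^ (n + 1) * f t) + b * I + J t) ^ P :=
              ENNReal.rpow_le_rpow h1 hP0.le
          _ ≤ K * ((a * (ENNReal.ofReal t ^ (n + 1) * f t) + b * I) ^ P + J t ^ P) :=
              ENNReal.rpow_add_le_mul_rpow_add_rpow _ _ hP.le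
          _ ≤ K * (K * ((a * (ENNReal.ofReal t ^ (n + 1) * f t)) ^ P + (b * I) ^ P) + J t ^ P) := by
              gcongr
              exact ENNReal.rpow_add_le_mul_rpow_add_rpow _ _ hP.le
          _ = _ := by
              rw [ENNReal.mul_rpow_of_nonneg a _ hP0.le]
              ring
    _ = K * K * a ^ P * A + K * K * (b * I) ^ P * ρ + K * ∫⁻ t in Ioo 0 r, J t ^ P := by
        rw [lintegral_add_left (by fun_prop), lintegral_add_left (by fun_prop),
          lintegral_const_mul' _ _ (by finiteness), lintegral_const_mul' _ _ hKt, lintegral_const,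
          Measure.restrict_apply_univ, Real.volume_Ioo, sub_zero]
    _ ≤ K * K * a ^ P * A + K * K * (b ^ P * (A * ρ ^ (P - 1))) * ρ + K * (c * B) := by
        rw [ENNReal.mul_rpow_of_nonneg b _ hP0.le]
        gcongr
    _ = (K * K * a ^ P + K * K * (b ^ P * ρ ^ (P - 1) * ρ)) * A + K * c * B := by ring
    _ ≤ (K * K * a ^ P + K * K * (b ^ P * ρ ^ (P - 1) * ρ) + K * c) * A +
        (K * K * a ^ P + K * K * (b ^ P * ρ ^ (P - 1) * ρ) + K * c) * B := by
        exact add_le_add (mul_le_mul_left le_self_add _) (mul_le_mul_left le_add_self _)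
    _ = _ := (mul_add _ _ _).symm

/-! ### Boundary charts -/

/-- A parametrization `(y, t) ↦ Ψ (y, t)` of a neighbourhood of a boundary point, affine in `t`,
of constant Jacobian, and such that `t` is comparable to the distance to the boundary. -/
structure BoundaryChart {d : ℕ} (Ω U : Set (Eucl (d + 1))) where
  Ψ : Eucl d × ℝ → Eucl (d + 1)
  e : Eucl (d + 1)
  c : ℝ≥0∞
  A : Set (Eucl d)
  r : ℝ
  C₁ : ℝ
  C₂ : ℝ
  measurable : Measurable Ψ
  c_ne_zero : c ≠ 0
  c_ne_top : c ≠ ∞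
  map_eq : Measure.map Ψ volume = c • volume
  apply_add : ∀ y t τ, Ψ (y, t + τ) = Ψ (y, t) + τ • e
  measurableSet : MeasurableSet A
  mem : ∀ y ∈ A, ∀ t ∈ Ioo 0 r, Ψ (y, t) ∈ Ω
  bdryDist_le : ∀ y ∈ A, ∀ t ∈ Ioo 0 r, bdryDist Ω (Ψ (y, t)) ≤ C₁ * t
  le_bdryDist : ∀ y ∈ A, ∀ t ∈ Ioo 0 r, t ≤ C₂ * bdryDist Ω (Ψ (y, t))
  preimage_subset : Ψ ⁻¹' (U ∩ Ω) ⊆ A ×ˢ Ioo 0 r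

/-- For each fixed `τ` the increment bound holds off a null set of points, which the chart pulls
back to a null set. Fubini then reorders the quantifiers, so that on almost every fibre the bound
holds for almost all `t` and `τ`. -/
theorem BoundaryChart.ae_increment_le {d : ℕ} {Ω U : Set (Eucl (d + 1))} (hΩ : IsOpen Ω)
    (ch : BoundaryChart Ω U) {u g : Eucl (d + 1) → ℂ} (h : HasWeakLineDeriv Ω ch.e u g)
    (hu : StronglyMeasurable u) (hg : StronglyMeasurable g) :
    ∀ᵐ y : Eucl d, y ∈ ch.A → ∀ᵐ t : ℝ, ∀ᵐ τ : ℝ, 0 < t → 0 < τ → t + τ < ch.r →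
      ‖u (ch.Ψ (y, t))‖ₑ ≤ ‖u (ch.Ψ (y, t + τ))‖ₑ + ∫⁻ σ in Ioc 0 τ, ‖g (ch.Ψ (y, t + σ))‖ₑ := by
  have hq : Measure.QuasiMeasurePreserving ch.Ψ volume volume :=
    ⟨ch.measurable, by rw [ch.map_eq]; exact Measure.smul_absolutelyContinuous⟩
  have h1 : ∀ τ : ℝ, ∀ᵐ z : Eucl d × ℝ, z.1 ∈ ch.A → 0 < z.2 → 0 < τ → z.2 + τ < ch.r →
      ‖u (ch.Ψ z)‖ₑ ≤ ‖u (ch.Ψ (z.1, z.2 + τ))‖ₑ +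
        ∫⁻ σ in Ioc 0 τ, ‖g (ch.Ψ (z.1, z.2 + σ))‖ₑ := by
    intro τ
    rcases le_or_gt τ 0 with hτ | hτ
    · exact Filter.Eventually.of_forall fun z _ _ h => absurd h hτ.not_gt
    filter_upwards [hq.ae (h.ae_enorm_le hΩ hu hg hτ.le)] with z hz hzA hz0 _ hzr
    simp only [ch.apply_add]
    refine hz fun σ hσ => ?_
    have := ch.mem z.1 hzA (z.2 + σ) ⟨by linarith [hσ.1], by linarith [hσ.2]⟩
    rwa [ch.apply_add] at this
  have hum : Measurable fun x => ‖u x‖ₑ := hu.measurable.enorm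
  have hgm : Measurable fun x => ‖g x‖ₑ := hg.measurable.enorm
  have hI : Measurable fun w : (Eucl d × ℝ) × ℝ =>
      ∫⁻ σ in Ioc 0 w.2, ‖g (ch.Ψ (w.1.1, w.1.2 + σ))‖ₑ := by
    -- The moving domain of integration is absorbed in an indicator, making joint measurability an
    -- instance of Tonelli.
    have : (fun w : (Eucl d × ℝ) × ℝ => ∫⁻ σ in Ioc 0 w.2, ‖g (ch.Ψ (w.1.1, w.1.2 + σ))‖ₑ) =
        fun w => ∫⁻ σ, {v : ((Eucl d × ℝ) × ℝ) × ℝ | 0 < v.2 ∧ v.2 ≤ v.1.2}.indicator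
          (fun v => ‖g (ch.Ψ (v.1.1.1, v.1.1.2 + v.2))‖ₑ) (w, σ) := by
      funext w
      rw [← lintegral_indicator measurableSet_Ioc]
      rfl
    rw [this]
    refine Measurable.lintegral_prod_right' (f := {v : ((Eucl d × ℝ) × ℝ) × ℝ |
      0 < v.2 ∧ v.2 ≤ v.1.2}.indicator fun v => ‖g (ch.Ψ (v.1.1.1, v.1.1.2 + v.2))‖ₑ) ?_
    refine Measurable.indicator (hgm.comp (ch.measurable.comp (by fun_prop))) ?_
    exact (measurableSet_lt measurable_const measurable_snd).inter
      (measurableSet_le measurable_snd (by fun_prop))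
  have hmeas : MeasurableSet {w : (Eucl d × ℝ) × ℝ | w.1.1 ∈ ch.A → 0 < w.1.2 → 0 < w.2 →
      w.1.2 + w.2 < ch.r → ‖u (ch.Ψ w.1)‖ₑ ≤ ‖u (ch.Ψ (w.1.1, w.1.2 + w.2))‖ₑ +
        ∫⁻ σ in Ioc 0 w.2, ‖g (ch.Ψ (w.1.1, w.1.2 + σ))‖ₑ} := by
    refine measurableSet_setOfPred.2 (Measurable.imp ?_ (Measurable.imp ?_ (Measurable.imp ?_
      (Measurable.imp ?_ ?_)))) <;> refine measurableSet_setOfPred.1 ?_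
    · exact (measurable_fst.comp measurable_fst) ch.measurableSet
    · exact measurableSet_lt measurable_const (by fun_prop)
    · exact measurableSet_lt measurable_const (by fun_prop)
    · exact measurableSet_lt (by fun_prop) measurable_const
    · exact measurableSet_le (hum.comp (ch.measurable.comp measurable_fst))
        ((hum.comp (ch.measurable.comp (by fun_prop))).add hI)
  have h2 := (Measure.ae_ae_comm (μ := (volume : Measure (Eucl d × ℝ)))
    (ν := (volume : Measure ℝ)) hmeas).2 (Filter.Eventually.of_forall h1)
  filter_upwards [Measure.ae_ae_of_ae_prod h2] with y hy hyA
  filter_upwards [hy] with t ht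
  filter_upwards [ht] with τ hτ
  exact hτ hyA

/-- Change of variables and Tonelli. The fibres cover `U ∩ Ω`, giving this bound, and stay in `Ω`,
giving the opposite one in `BoundaryChart.le_setLIntegral`; both carry the same Jacobian factor,
which later cancels. -/
theorem BoundaryChart.setLIntegral_le {d : ℕ} {Ω U : Set (Eucl (d + 1))}
    (ch : BoundaryChart Ω U) (hU : MeasurableSet (U ∩ Ω)) {F : Eucl (d + 1) → ℝ≥0∞}
    (hF : Measurable F) :
    ch.c * ∫⁻ x in U ∩ Ω, F x ≤ ∫⁻ y in ch.A, ∫⁻ t in Ioo 0 ch.r, F (ch.Ψ (y, t)) := by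
  calc ch.c * ∫⁻ x in U ∩ Ω, F x = ∫⁻ x in U ∩ Ω, F x ∂(Measure.map ch.Ψ volume) := by
        rw [ch.map_eq, Measure.restrict_smul, lintegral_smul_measure, smul_eq_mul]
    _ = ∫⁻ z in ch.Ψ ⁻¹' (U ∩ Ω), F (ch.Ψ z) := setLIntegral_map hU hF ch.measurable
    _ ≤ ∫⁻ z in ch.A ×ˢ Ioo 0 ch.r, F (ch.Ψ z) := lintegral_mono_set ch.preimage_subset
    _ = _ := by
        rw [Measure.volume_eq_prod, ← Measure.prod_restrict, lintegral_prod]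
        exact (hF.comp ch.measurable).aemeasurable

theorem BoundaryChart.le_setLIntegral {d : ℕ} {Ω U : Set (Eucl (d + 1))}
    (ch : BoundaryChart Ω U) (hΩ : MeasurableSet Ω) {F : Eucl (d + 1) → ℝ≥0∞}
    (hF : Measurable F) :
    ∫⁻ y in ch.A, ∫⁻ t in Ioo 0 ch.r, F (ch.Ψ (y, t)) ≤ ch.c * ∫⁻ x in Ω, F x := by
  calc ∫⁻ y in ch.A, ∫⁻ t in Ioo 0 ch.r, F (ch.Ψ (y, t))
      = ∫⁻ z in ch.A ×ˢ Ioo 0 ch.r, F (ch.Ψ z) := by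
        rw [Measure.volume_eq_prod, ← Measure.prod_restrict, lintegral_prod]
        exact (hF.comp ch.measurable).aemeasurable
    _ ≤ ∫⁻ z in ch.Ψ ⁻¹' Ω, F (ch.Ψ z) :=
        lintegral_mono_set fun z hz => ch.mem z.1 hz.1 z.2 hz.2
    _ = ∫⁻ x in Ω, F x ∂(Measure.map ch.Ψ volume) := (setLIntegral_map hΩ hF ch.measurable).symm
    _ = _ := by rw [ch.map_eq, Measure.restrict_smul, lintegral_smul_measure, smul_eq_mul]

theorem measurable_bdryDist {N : ℕ} (Ω : Set (Eucl N)) : Measurable (bdryDist Ω) :=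
  (Metric.continuous_infDist_pt _).measurable

/-- The weighted `L^P` energy `∫_S (δ^n |f|)^P`. -/
def weightedEnergy {N : ℕ} (Ω S : Set (Eucl N)) (P : ℝ) (n : ℕ) (f : Eucl N → ℂ) : ℝ≥0∞ :=
  ∫⁻ x in S, (ENNReal.ofReal (bdryDist Ω x) ^ n * ‖f x‖ₑ) ^ P

/-- Hardy's inequality near a boundary point. -/
theorem BoundaryChart.exists_hardy {d : ℕ} {Ω U : Set (Eucl (d + 1))} (hΩ : IsOpen Ω)
    (hU : IsOpen U) (ch : BoundaryChart Ω U) {P : ℝ} (hP : 1 < P) (n : ℕ) :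
    ∃ C : ℝ≥0∞, C ≠ ∞ ∧ ∀ u g : Eucl (d + 1) → ℂ, StronglyMeasurable u → StronglyMeasurable g →
      HasWeakLineDeriv Ω ch.e u g →
      weightedEnergy Ω (U ∩ Ω) P n u ≤
        C * (weightedEnergy Ω Ω P (n + 1) u + weightedEnergy Ω Ω P (n + 1) g) := by
  have hP0 : 0 < P := by linarith
  obtain ⟨C, hC, hH⟩ := exists_lintegral_hardy_of_increment_le hP n ch.r
  -- `a` pays for replacing `δ^n` by `t^n` on the left, `b` for replacing `t^(n+1)` by `δ^(n+1)` on
  -- the right.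
  set a := (ENNReal.ofReal ch.C₁ ^ n) ^ P with ha
  set b := (ENNReal.ofReal ch.C₂ ^ (n + 1)) ^ P with hb
  have hat : a ≠ ∞ := ENNReal.rpow_ne_top_of_nonneg hP0.le (by finiteness)
  have hbt : b ≠ ∞ := ENNReal.rpow_ne_top_of_nonneg hP0.le (by finiteness)
  refine ⟨a * C * b, by finiteness, fun u g hu hg h => ?_⟩
  have hδ : Measurable fun x => ENNReal.ofReal (bdryDist Ω x) := (measurable_bdryDist Ω).ennreal_ofReal
  have hF : ∀ (m : ℕ) (f : Eucl (d + 1) → ℂ), StronglyMeasurable f →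
      Measurable fun x => (ENNReal.ofReal (bdryDist Ω x) ^ m * ‖f x‖ₑ) ^ P := fun m f hf =>
    ((hδ.pow_const m).mul hf.measurable.enorm).pow_const P
  have hΨ : ∀ f : Eucl (d + 1) → ℂ, StronglyMeasurable f → ∀ y : Eucl d,
      Measurable fun t : ℝ => ‖f (ch.Ψ (y, t))‖ₑ := fun f hf y =>
    hf.measurable.enorm.comp (ch.measurable.comp (by fun_prop))
  have hlow : ∀ f : Eucl (d + 1) → ℂ, ∀ y ∈ ch.A,
      ∫⁻ t in Ioo 0 ch.r, (ENNReal.ofReal t ^ (n + 1) * ‖f (ch.Ψ (y, t))‖ₑ) ^ P ≤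
      b * ∫⁻ t in Ioo 0 ch.r,
        (ENNReal.ofReal (bdryDist Ω (ch.Ψ (y, t))) ^ (n + 1) * ‖f (ch.Ψ (y, t))‖ₑ) ^ P := by
    intro f y hy
    rw [← lintegral_const_mul' _ _ hbt]
    refine setLIntegral_mono' measurableSet_Ioo fun t ht => ?_
    rw [hb, ← ENNReal.mul_rpow_of_nonneg _ _ hP0.le, ← mul_assoc, ← mul_pow,
      ← ENNReal.ofReal_mul' (show 0 ≤ bdryDist Ω _ from Metric.infDist_nonneg)]
    have := ch.le_bdryDist y hy t ht
    gcongr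
  have hup : ∀ y ∈ ch.A, ∫⁻ t in Ioo 0 ch.r,
        (ENNReal.ofReal (bdryDist Ω (ch.Ψ (y, t))) ^ n * ‖u (ch.Ψ (y, t))‖ₑ) ^ P ≤
      a * ∫⁻ t in Ioo 0 ch.r, (ENNReal.ofReal t ^ n * ‖u (ch.Ψ (y, t))‖ₑ) ^ P := by
    intro y hy
    rw [← lintegral_const_mul' _ _ hat]
    refine setLIntegral_mono' measurableSet_Ioo fun t ht => ?_
    rw [ha, ← ENNReal.mul_rpow_of_nonneg _ _ hP0.le, ← mul_assoc, ← mul_pow,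
      ← ENNReal.ofReal_mul' ht.1.le]
    have := ch.bdryDist_le y hy t ht
    gcongr
  have hfib : ∀ f : Eucl (d + 1) → ℂ, StronglyMeasurable f → Measurable fun y : Eucl d =>
      ∫⁻ t in Ioo 0 ch.r,
        (ENNReal.ofReal (bdryDist Ω (ch.Ψ (y, t))) ^ (n + 1) * ‖f (ch.Ψ (y, t))‖ₑ) ^ P :=
    fun f hf => ((hF (n + 1) f hf).comp ch.measurable).lintegral_prod_right'
  have hmain : ch.c * weightedEnergy Ω (U ∩ Ω) P n u ≤
      ch.c * (a * C * b * (weightedEnergy Ω Ω P (n + 1) u + weightedEnergy Ω Ω P (n + 1) g)) := by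
    calc ch.c * weightedEnergy Ω (U ∩ Ω) P n u
        ≤ ∫⁻ y in ch.A, ∫⁻ t in Ioo 0 ch.r,
            (ENNReal.ofReal (bdryDist Ω (ch.Ψ (y, t))) ^ n * ‖u (ch.Ψ (y, t))‖ₑ) ^ P :=
          ch.setLIntegral_le (hU.inter hΩ).measurableSet (hF n u hu)
      _ ≤ ∫⁻ y in ch.A, a * C * b *
          ((∫⁻ t in Ioo 0 ch.r,
            (ENNReal.ofReal (bdryDist Ω (ch.Ψ (y, t))) ^ (n + 1) * ‖u (ch.Ψ (y, t))‖ₑ) ^ P) +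
          ∫⁻ t in Ioo 0 ch.r,
            (ENNReal.ofReal (bdryDist Ω (ch.Ψ (y, t))) ^ (n + 1) * ‖g (ch.Ψ (y, t))‖ₑ) ^ P) := by
          refine lintegral_mono_ae ?_
          filter_upwards [ae_restrict_mem ch.measurableSet,
            ae_restrict_of_ae (ch.ae_increment_le hΩ h hu hg)] with y hy hyi
          have hh := hH _ _ (hΨ u hu y) (hΨ g hg y) (hyi hy)
          refine (hup y hy).trans ?_
          rw [mul_assoc, mul_assoc, mul_add b]
          gcongr
          refine hh.trans ?_
          gcongr
          · exact hlow u y hy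
          · exact hlow g y hy
      _ = a * C * b * ((∫⁻ y in ch.A, ∫⁻ t in Ioo 0 ch.r,
            (ENNReal.ofReal (bdryDist Ω (ch.Ψ (y, t))) ^ (n + 1) * ‖u (ch.Ψ (y, t))‖ₑ) ^ P) +
          ∫⁻ y in ch.A, ∫⁻ t in Ioo 0 ch.r,
            (ENNReal.ofReal (bdryDist Ω (ch.Ψ (y, t))) ^ (n + 1) * ‖g (ch.Ψ (y, t))‖ₑ) ^ P) := by
          rw [lintegral_const_mul' _ _ (by finiteness), lintegral_add_left (hfib u hu)]
      _ ≤ a * C * b * (ch.c * weightedEnergy Ω Ω P (n + 1) u +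
            ch.c * weightedEnergy Ω Ω P (n + 1) g) := by
          gcongr
          · exact ch.le_setLIntegral hΩ.measurableSet (hF (n + 1) u hu)
          · exact ch.le_setLIntegral hΩ.measurableSet (hF (n + 1) g hg)
      _ = _ := by ring
  exact (ENNReal.mul_le_mul_iff_right ch.c_ne_zero ch.c_ne_top).1 hmain

/-! ### Existence of boundary charts -/

/-- The point `(y, s)` of `ℝ^{d+1}`. -/
def join {d : ℕ} (z : Eucl d × ℝ) : Eucl (d + 1) :=
  WithLp.toLp 2 (Fin.insertNth (α := fun _ => ℝ) (Fin.last d) z.2 z.1.ofLp)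

theorem join_last {d : ℕ} (z : Eucl d × ℝ) : join z (Fin.last d) = z.2 := by
  simp [join]

theorem join_castSucc {d : ℕ} (z : Eucl d × ℝ) (i : Fin d) : join z i.castSucc = z.1 i := by
  have := Fin.insertNth_apply_succAbove (α := fun _ => ℝ) (Fin.last d) z.2 z.1.ofLp i
  rw [Fin.succAbove_last] at this
  exact this

theorem head_join {d : ℕ} (z : Eucl d × ℝ) : head (join z) = z.1 := by
  ext i
  simp [head, join_castSucc]

theorem join_head {d : ℕ} (x : Eucl (d + 1)) : join (head x, x (Fin.last d)) = x := by
  ext i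
  refine Fin.lastCases ?_ (fun i => ?_) i
  · rw [join_last]
  · rw [join_castSucc]; rfl

theorem join_add {d : ℕ} (y : Eucl d) (s τ : ℝ) :
    join (y, s + τ) = join (y, s) + τ • EuclideanSpace.single (Fin.last d) (1 : ℝ) := by
  ext i
  refine Fin.lastCases ?_ (fun i => ?_) i
  · simp [join_last]
  · simp [join_castSucc]

theorem norm_sq_eq_head_add {d : ℕ} (x : Eucl (d + 1)) :
    ‖x‖ ^ 2 = ‖head x‖ ^ 2 + x (Fin.last d) ^ 2 := by
  simp [EuclideanSpace.norm_sq_eq, Fin.sum_univ_castSucc, head]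

theorem head_sub {d : ℕ} (x y : Eucl (d + 1)) : head (x - y) = head x - head y := by
  ext i; simp [head]

theorem norm_head_le {d : ℕ} (x : Eucl (d + 1)) : ‖head x‖ ≤ ‖x‖ :=
  le_of_sq_le_sq (by rw [norm_sq_eq_head_add]; nlinarith [sq_nonneg (x (Fin.last d))]) (norm_nonneg _)

theorem norm_le_head_add {d : ℕ} (x : Eucl (d + 1)) : ‖x‖ ≤ ‖head x‖ + |x (Fin.last d)| := by
  refine le_of_sq_le_sq ?_ (by positivity)
  rw [norm_sq_eq_head_add, add_sq, sq_abs]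
  have : 0 ≤ 2 * ‖head x‖ * |x (Fin.last d)| := by positivity
  linarith

theorem continuous_head {d : ℕ} : Continuous (head : Eucl (d + 1) → Eucl d) := by
  unfold head
  fun_prop

theorem measurePreserving_join (d : ℕ) :
    MeasurePreserving (join : Eucl d × ℝ → Eucl (d + 1)) volume volume := by
  have h1 : MeasurePreserving (Prod.swap : Eucl d × ℝ → ℝ × Eucl d) volume volume :=
    Measure.measurePreserving_swap
  have h2 : MeasurePreserving (Prod.map id WithLp.ofLp : ℝ × Eucl d → ℝ × (Fin d → ℝ))
      volume volume :=
    (MeasurePreserving.id volume).prod (PiLp.volume_preserving_ofLp (Fin d))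
  have h3 := (volume_preserving_piFinSuccAbove (fun _ : Fin (d + 1) => ℝ) (Fin.last d)).symm
  have h4 := PiLp.volume_preserving_toLp (Fin (d + 1))
  exact h4.comp (h3.comp (h2.comp h1))

/-- Sliding along the graph of `ρ`. -/
theorem measurePreserving_shear {d : ℕ} {ρ : Eucl d → ℝ} (hρ : Measurable ρ) :
    MeasurePreserving (fun z : Eucl d × ℝ => (z.1, ρ z.1 + z.2)) volume volume :=
  MeasurePreserving.skew_product (g := fun y t => ρ y + t) (MeasurePreserving.id volume)
    (by fun_prop) (Filter.Eventually.of_forall fun y => map_add_left_eq_self volume (ρ y))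

theorem exists_map_affineEquiv_volume {N : ℕ} (Φ : Eucl N ≃ᵃ[ℝ] Eucl N) :
    ∃ c : ℝ≥0∞, c ≠ 0 ∧ c ≠ ∞ ∧ Measure.map Φ volume = c • (volume : Measure (Eucl N)) := by
  have hdet : LinearMap.det (Φ.linear : Eucl N →ₗ[ℝ] Eucl N) ≠ 0 :=
    (LinearEquiv.isUnit_det' Φ.linear).ne_zero
  refine ⟨ENNReal.ofReal |(LinearMap.det (Φ.linear : Eucl N →ₗ[ℝ] Eucl N))⁻¹|, by simpa using hdet,
    ENNReal.ofReal_ne_top, ?_⟩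
  have hΦ : (Φ : Eucl N → Eucl N) =
      (fun x => x + Φ 0) ∘ (Φ.linear : Eucl N →ₗ[ℝ] Eucl N) := by
    funext x
    have := Φ.map_vadd 0 x
    simpa using this
  have hc : Continuous (Φ.linear : Eucl N →ₗ[ℝ] Eucl N) := LinearMap.continuous_of_finiteDimensional _
  rw [hΦ, ← Measure.map_map (by fun_prop) hc.measurable,
    Measure.map_linearMap_addHaar_eq_smul_addHaar volume hdet, Measure.map_smul,
    map_add_right_eq_self]

/-- The height `x_{d+1} - ρ(x')` above the graph of `ρ`. -/
def height {d : ℕ} (ρ : Eucl d → ℝ) (x : Eucl (d + 1)) : ℝ := x (Fin.last d) - ρ (head x)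

theorem continuous_height {d : ℕ} {ρ : Eucl d → ℝ} (hρ : Continuous ρ) :
    Continuous (height ρ) := by
  have h : Continuous fun x : Eucl (d + 1) => x (Fin.last d) := by fun_prop
  exact h.sub (hρ.comp continuous_head)

theorem height_join {d : ℕ} (ρ : Eucl d → ℝ) (y : Eucl d) (t : ℝ) :
    height ρ (join (y, ρ y + t)) = t := by
  rw [height, join_last, head_join]; simp

/-- Taking `w` on the graph, this bounds the height of `x` by twice its distance to the graph, the
nontrivial half of the comparison with `δ`. -/
theorem abs_height_sub_le {d : ℕ} {ρ : Eucl d → ℝ} {K : ℝ≥0} (hK : LipschitzWith K ρ)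
    (hK1 : (K : ℝ) ≤ 1) (x w : Eucl (d + 1)) : |height ρ x - height ρ w| ≤ 2 * ‖x - w‖ := by
  have h1 : |ρ (head x) - ρ (head w)| ≤ ‖x - w‖ := by
    have h := hK.dist_le_mul (head x) (head w)
    rw [Real.dist_eq, dist_eq_norm, ← head_sub] at h
    refine h.trans (le_trans ?_ (norm_head_le _))
    exact mul_le_of_le_one_left (norm_nonneg _) hK1
  have h2 : |x (Fin.last d) - w (Fin.last d)| ≤ ‖x - w‖ := by
    have := PiLp.norm_apply_le (x - w) (Fin.last d)
    simpa using this
  have : height ρ x - height ρ w =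
      (x (Fin.last d) - w (Fin.last d)) - (ρ (head x) - ρ (head w)) := by
    simp only [height]; ring
  rw [this]
  linarith [abs_sub (x (Fin.last d) - w (Fin.last d)) (ρ (head x) - ρ (head w))]

/-- In the ball where `Ω` is the region above a graph, its boundary is the graph. -/
theorem mem_frontier_iff_height_eq_zero {d : ℕ} {Ω : Set (Eucl (d + 1))} (hΩ : IsOpen Ω)
    (Φ : Eucl (d + 1) ≃ₜ Eucl (d + 1)) {ρ : Eucl d → ℝ} (hρ : Continuous ρ)
    {B : Set (Eucl (d + 1))} (hB : IsOpen B) (hmem : ∀ x ∈ B, Φ x ∈ Ω ↔ 0 < height ρ x)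
    {x : Eucl (d + 1)} (hx : x ∈ B) : Φ x ∈ frontier Ω ↔ height ρ x = 0 := by
  rw [hΩ.frontier_eq, mem_sdiff, hmem x hx, not_lt]
  have hpre : Φ x ∈ closure Ω ↔ x ∈ closure (Φ ⁻¹' Ω) := by
    rw [← Φ.preimage_closure]; rfl
  rw [hpre]
  constructor
  -- Points of negative height have a neighbourhood missing `Ω`; conversely a point of the graph is
  -- the limit of the points vertically above it.
  · rintro ⟨hcl, hle⟩
    refine le_antisymm hle (le_of_not_gt fun hlt => ?_)
    have hV : IsOpen (B ∩ {y | height ρ y < 0}) :=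
      hB.inter (isOpen_lt (continuous_height hρ) continuous_const)
    obtain ⟨y, ⟨hyB, hy0⟩, hyΩ⟩ := mem_closure_iff.1 hcl _ hV ⟨hx, hlt⟩
    exact lt_asymm hy0 ((hmem y hyB).1 hyΩ)
  · intro h0
    refine ⟨?_, h0.le⟩
    have hx' : join (head x, ρ (head x) + 0) = x := by
      have : ρ (head x) + 0 = x (Fin.last d) := by
        simp only [height] at h0; linarith
      rw [this, join_head]
    have hcont : Continuous fun t : ℝ => join (head x, ρ (head x) + t) := by
      simp_rw [join_add]; fun_prop
    have htend : Filter.Tendsto (fun t : ℝ => join (head x, ρ (head x) + t))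
        (nhdsWithin 0 (Ioi 0)) (nhds x) := by
      have := (hcont.tendsto 0).mono_left (nhdsWithin_le_nhds (s := Ioi 0))
      rwa [hx'] at this
    refine mem_closure_of_tendsto htend ?_
    filter_upwards [htend (hB.mem_nhds hx), self_mem_nhdsWithin] with t htB ht
    refine (hmem _ htB).2 ?_
    rw [height_join]
    exact ht

/-- The chart is `(y, t) ↦ Φ (y, ρ(y) + t)`: a shear, which preserves volume, followed by an affine
map. Dropping vertically to the graph bounds `δ` by a multiple of `t`. Conversely, boundary points
in the chart's ball lie on the graph, where the Lipschitz bound on the height applies, and the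
remaining ones are too far away to matter. -/
theorem exists_boundaryChart {d : ℕ} {Ω : Set (Eucl (d + 1))} (hΩ : IsBoundedLipschitzDomain Ω)
    {q : Eucl (d + 1)} (hq : q ∈ frontier Ω) :
    ∃ U : Set (Eucl (d + 1)), IsOpen U ∧ q ∈ U ∧ Nonempty (BoundaryChart Ω U) := by
  obtain ⟨hΩo, -, hΩq⟩ := hΩ
  obtain ⟨Φ, ω, ⟨ρ, M, K, hM, hK, hMK, rfl⟩, ⟨x₀, hx₀, rfl⟩, hΦ⟩ := hΩq q hq
  have hK1 : (K : ℝ) ≤ 1 := by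
    have := (abs_nonneg _).trans (hM 0)
    linarith
  have hρ : Continuous ρ := hK.continuous
  let H : Eucl (d + 1) ≃ₜ Eucl (d + 1) :=
    { Φ.toEquiv with
      continuous_toFun := Φ.continuous_of_finiteDimensional
      continuous_invFun := Φ.symm.continuous_of_finiteDimensional }
  have hmem : ∀ x ∈ Metric.ball (0 : Eucl (d + 1)) 1, Φ x ∈ Ω ↔ 0 < height ρ x := by
    intro x hx
    have h1 : Φ x ∈ Ω ∩ Φ '' Metric.ball 0 1 ↔ Φ x ∈ Φ '' (epigraph ρ ∩ Metric.ball 0 1) := by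
      rw [hΦ]
    rw [mem_inter_iff, Φ.injective.mem_set_image, Φ.injective.mem_set_image, mem_inter_iff,
      and_iff_left hx, and_iff_left hx] at h1
    rw [h1, height, sub_pos]
    rfl
  have hfr : ∀ x ∈ Metric.ball (0 : Eucl (d + 1)) 1, Φ x ∈ frontier Ω ↔ height ρ x = 0 :=
    fun x hx => mem_frontier_iff_height_eq_zero hΩo H hρ Metric.isOpen_ball hmem hx
  obtain ⟨R, hR, hRB⟩ := Metric.isOpen_iff.1 Metric.isOpen_ball x₀ hx₀
  have hh₀ : height ρ x₀ = 0 := (hfr x₀ hx₀).1 hq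
  let Lc : Eucl (d + 1) ≃L[ℝ] Eucl (d + 1) := Φ.linear.toContinuousLinearEquiv
  have hadd : ∀ x v, Φ (x + v) = Φ x + Lc v := by
    intro x v
    have := Φ.map_vadd x v
    rw [vadd_eq_add, vadd_eq_add, add_comm v x, add_comm _ (Φ x)] at this
    exact this
  have hdist : ∀ x w, ‖x - w‖ ≤ ‖(Lc.symm : Eucl (d + 1) →L[ℝ] Eucl (d + 1))‖ * dist (Φ x) (Φ w) := by
    intro x w
    have h1 : Φ x - Φ w = Lc (x - w) := by
      have := hadd w (x - w)
      rw [add_sub_cancel] at this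
      rw [this]; simp
    have h2 : x - w = (Lc.symm : Eucl (d + 1) →L[ℝ] Eucl (d + 1)) (Φ x - Φ w) := by
      rw [h1]; simp
    rw [dist_eq_norm]
    conv_lhs => rw [h2]
    exact ContinuousLinearMap.le_opNorm _ _
  set Λ := ‖(Lc.symm : Eucl (d + 1) →L[ℝ] Eucl (d + 1))‖ with hΛ
  set r := R / 4 with hr
  have hr0 : 0 < r := by positivity
  set A := Metric.ball (head x₀) r with hA
  have hnear : ∀ y ∈ A, ∀ t : ℝ, |t| < r → ‖join (y, ρ y + t) - x₀‖ < 3 * r := by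
    intro y hy t ht
    have h1 := norm_le_head_add (join (y, ρ y + t) - x₀)
    rw [head_sub, head_join, PiLp.sub_apply, join_last] at h1
    rw [hA, mem_ball_iff_norm] at hy
    have h2 : |ρ y - ρ (head x₀)| ≤ ‖y - head x₀‖ := by
      have h := hK.dist_le_mul y (head x₀)
      rw [Real.dist_eq, dist_eq_norm] at h
      exact h.trans (mul_le_of_le_one_left (norm_nonneg _) hK1)
    have h3 : x₀ (Fin.last d) = ρ (head x₀) := by
      simp only [height] at hh₀; linarith
    have h4 : |ρ y + t - ρ (head x₀)| ≤ |ρ y - ρ (head x₀)| + |t| := by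
      have := abs_add_le (ρ y - ρ (head x₀)) t
      rwa [sub_add_eq_add_sub] at this
    simp only [h3] at h1
    linarith
  have hball : ∀ y ∈ A, ∀ t : ℝ, |t| < r → join (y, ρ y + t) ∈ Metric.ball (0 : Eucl (d + 1)) 1 := by
    intro y hy t ht
    refine hRB ?_
    rw [mem_ball_iff_norm]
    have := hnear y hy t ht
    linarith
  have habs : ∀ t ∈ Ioo 0 r, |t| < r := fun t ht => by rw [abs_of_pos ht.1]; exact ht.2
  obtain ⟨c, hc0, hct, hc⟩ := exists_map_affineEquiv_volume Φ
  have hshear := (measurePreserving_join d).comp (measurePreserving_shear hρ.measurable)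
  have hΦm : Measurable Φ := H.continuous.measurable
  have hΨadd : ∀ (y : Eucl d) (t τ : ℝ), Φ (join (y, ρ y + (t + τ))) =
      Φ (join (y, ρ y + t)) + τ • Lc (EuclideanSpace.single (Fin.last d) 1) := by
    intro y t τ
    rw [← add_assoc, join_add, hadd, map_smul]
  -- The neighbourhood is two-sided so as to be open around `q`; intersecting with `Ω` keeps the
  -- heights in `(0, r)`.
  refine ⟨H.symm ⁻¹' {x | head x ∈ A ∧ |height ρ x| < r}, ?_, ?_, ⟨{
    Ψ := fun z => Φ (join (z.1, ρ z.1 + z.2))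
    e := Lc (EuclideanSpace.single (Fin.last d) 1)
    c := c
    A := A
    r := r
    C₁ := ‖Lc (EuclideanSpace.single (Fin.last d) 1)‖
    -- `2 * Λ` serves boundary points in the ball, through the Lipschitz height, and `Λ` those
    -- outside it; the sum serves both.
    C₂ := 2 * Λ + Λ
    measurable := hΦm.comp hshear.measurable
    c_ne_zero := hc0
    c_ne_top := hct
    map_eq := ?_
    apply_add := hΨadd
    measurableSet := measurableSet_ball
    mem := ?_
    bdryDist_le := ?_
    le_bdryDist := ?_
    preimage_subset := ?_ }⟩⟩
  · refine IsOpen.preimage H.symm.continuous (IsOpen.inter ?_ ?_)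
    · exact Metric.isOpen_ball.preimage continuous_head
    · exact isOpen_lt (continuous_height hρ).abs continuous_const
  · have : H.symm (Φ x₀) = x₀ := H.symm_apply_apply x₀
    simp [this, hA, hr0, hh₀]
  · have := Measure.map_map (μ := volume) hΦm hshear.measurable
    rw [hshear.map_eq, hc] at this
    exact this.symm
  · intro y hy t ht
    refine (hmem _ (hball y hy t (habs t ht))).2 ?_
    rw [height_join]
    exact ht.1
  · intro y hy t ht
    have h0 : Φ (join (y, ρ y + 0)) ∈ frontier Ω :=
      (hfr _ (hball y hy 0 (by simpa using hr0))).2 (height_join _ _ _)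
    refine (Metric.infDist_le_dist_of_mem h0).trans_eq ?_
    have := hΨadd y 0 t
    rw [zero_add] at this
    simp only [this]
    rw [dist_eq_norm, add_sub_cancel_left, norm_smul, Real.norm_of_nonneg ht.1.le, mul_comm]
  · intro y hy t ht
    have hxB := hnear y hy t (habs t ht)
    set x := join (y, ρ y + t) with hx
    have hhx : height ρ x = t := height_join _ _ _
    have hΛ0 : 0 ≤ Λ := norm_nonneg _
    have key : ∀ z ∈ frontier Ω, t ≤ (2 * Λ + Λ) * dist (Φ x) z := by
      intro z hz
      obtain ⟨w, rfl⟩ := Φ.surjective z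
      have hd := hdist x w
      have hdn : 0 ≤ Λ * dist (Φ x) (Φ w) := by positivity
      by_cases hw : w ∈ Metric.ball (0 : Eucl (d + 1)) 1
      · have hw0 := (hfr w hw).1 hz
        have := abs_height_sub_le hK hK1 x w
        rw [hhx, hw0, sub_zero, abs_of_pos ht.1] at this
        linarith
      · have hw1 : R ≤ ‖w - x₀‖ := by
          refine le_of_not_gt fun h => hw (hRB ?_)
          rwa [mem_ball_iff_norm]
        have h3 : ‖w - x₀‖ ≤ ‖x - w‖ + ‖x - x₀‖ := by
          have := norm_sub_le_norm_sub_add_norm_sub w x x₀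
          rwa [norm_sub_rev w x] at this
        have := ht.2
        linarith
    have hΛpos : 0 < 2 * Λ + Λ := by
      by_contra hneg
      have := key _ hq
      have h2 : (2 * Λ + Λ) * dist (Φ x) (Φ x₀) ≤ 0 :=
        mul_nonpos_of_nonpos_of_nonneg (not_lt.1 hneg) dist_nonneg
      linarith [ht.1]
    rw [← div_le_iff₀' hΛpos]
    refine (Metric.le_infDist ⟨_, hq⟩).2 fun z hz => ?_
    rw [div_le_iff₀' hΛpos]
    exact key z hz
  · rintro ⟨y, t⟩ ⟨hzU, hzΩ⟩
    have h1 : H.symm (Φ (join (y, ρ y + t))) = join (y, ρ y + t) := H.symm_apply_apply _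
    simp only [mem_preimage, h1, mem_ofPred_eq, head_join, height_join] at hzU
    have h2 := (hmem _ (hball y hzU.1 t hzU.2)).1 hzΩ
    rw [height_join] at h2
    exact ⟨hzU.1, h2, (abs_lt.1 hzU.2).2⟩

/-! ### Hardy's inequality on bounded Lipschitz domains -/

theorem weightedEnergy_congr {N : ℕ} {Ω S : Set (Eucl N)} {P : ℝ} {n : ℕ} {f f' : Eucl N → ℂ}
    (h : f =ᵐ[volume.restrict S] f') : weightedEnergy Ω S P n f = weightedEnergy Ω S P n f' :=
  lintegral_congr_ae (h.mono fun x hx => by simp only [hx])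

theorem weightedEnergy_union_le {N : ℕ} {Ω S T : Set (Eucl N)} {P : ℝ} {n : ℕ} {f : Eucl N → ℂ} :
    weightedEnergy Ω (S ∪ T) P n f ≤ weightedEnergy Ω S P n f + weightedEnergy Ω T P n f :=
  lintegral_union_le _ _ _

theorem weightedEnergy_mono_set {N : ℕ} {Ω S T : Set (Eucl N)} (h : S ⊆ T) {P : ℝ} {n : ℕ}
    {f : Eucl N → ℂ} : weightedEnergy Ω S P n f ≤ weightedEnergy Ω T P n f :=
  lintegral_mono_set h

/-- Each chart has its own direction `e`; this replaces the derivative along `e` by all partial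
derivatives, so that the estimates from different charts can be added. -/
theorem exists_weightedEnergy_sum_le {N : ℕ} (Ω S : Set (Eucl N)) {P : ℝ} (hP : 1 < P) (n : ℕ)
    (e : Eucl N) : ∃ C : ℝ≥0∞, C ≠ ∞ ∧ ∀ g : Fin N → Eucl N → ℂ,
      (∀ i, StronglyMeasurable (g i)) →
      weightedEnergy Ω S P n (fun x => ∑ i, e i • g i x) ≤ C * ∑ i, weightedEnergy Ω S P n (g i) := by
  have hP0 : 0 < P := by linarith
  set M : ℝ≥0∞ := (ENNReal.ofReal ‖e‖) ^ P with hM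
  set K : ℝ≥0∞ := (N : ℝ≥0∞) ^ (P - 1) with hK
  have hMt : M ≠ ∞ := ENNReal.rpow_ne_top_of_nonneg hP0.le ENNReal.ofReal_ne_top
  have hKt : K ≠ ∞ := ENNReal.rpow_ne_top_of_nonneg (by linarith) (by simp)
  refine ⟨K * M, by finiteness, fun g hg => ?_⟩
  have hm : ∀ i, Measurable fun x => (ENNReal.ofReal (bdryDist Ω x) ^ n * ‖g i x‖ₑ) ^ P := fun i =>
    (((measurable_bdryDist Ω).ennreal_ofReal.pow_const n).mul (hg i).measurable.enorm).pow_const P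
  have hpt : ∀ x, (ENNReal.ofReal (bdryDist Ω x) ^ n * ‖∑ i, e i • g i x‖ₑ) ^ P ≤
      K * M * ∑ i, (ENNReal.ofReal (bdryDist Ω x) ^ n * ‖g i x‖ₑ) ^ P := by
    intro x
    have h1 : ENNReal.ofReal (bdryDist Ω x) ^ n * ‖∑ i, e i • g i x‖ₑ ≤
        ∑ i, ENNReal.ofReal ‖e‖ * (ENNReal.ofReal (bdryDist Ω x) ^ n * ‖g i x‖ₑ) := by
      calc _ ≤ ENNReal.ofReal (bdryDist Ω x) ^ n * ∑ i, ‖e i • g i x‖ₑ := by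
            gcongr
            exact enorm_sum_le _ _
        _ ≤ _ := by
            rw [Finset.mul_sum]
            refine Finset.sum_le_sum fun i _ => ?_
            rw [enorm_smul, mul_left_comm]
            gcongr
            rw [← ofReal_norm]
            exact ENNReal.ofReal_le_ofReal (PiLp.norm_apply_le e i)
    refine (ENNReal.rpow_le_rpow h1 hP0.le).trans ?_
    have h2 := ENNReal.rpow_sum_le_const_mul_sum_rpow (Finset.univ : Finset (Fin N))
      (fun i => ENNReal.ofReal ‖e‖ * (ENNReal.ofReal (bdryDist Ω x) ^ n * ‖g i x‖ₑ)) hP.le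
    rw [Finset.card_univ, Fintype.card_fin] at h2
    refine h2.trans_eq ?_
    simp_rw [ENNReal.mul_rpow_of_nonneg (ENNReal.ofReal ‖e‖) _ hP0.le]
    rw [← Finset.mul_sum, mul_assoc]
  calc weightedEnergy Ω S P n (fun x => ∑ i, e i • g i x)
      ≤ ∫⁻ x in S, K * M * ∑ i, (ENNReal.ofReal (bdryDist Ω x) ^ n * ‖g i x‖ₑ) ^ P :=
        lintegral_mono hpt
    _ = _ := by
        rw [lintegral_const_mul' _ _ (by finiteness), lintegral_finsetSum _ fun i _ => hm i]
        rfl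

/-- Hardy's inequality in a neighbourhood of the boundary. -/
theorem exists_hardy_near_frontier {d : ℕ} {Ω : Set (Eucl (d + 1))}
    (hΩ : IsBoundedLipschitzDomain Ω) {P : ℝ} (hP : 1 < P) (n : ℕ) :
    ∃ U : Set (Eucl (d + 1)), IsOpen U ∧ frontier Ω ⊆ U ∧ ∃ C : ℝ≥0∞, C ≠ ∞ ∧
      ∀ (u : Eucl (d + 1) → ℂ) (g : Fin (d + 1) → Eucl (d + 1) → ℂ), StronglyMeasurable u →
      (∀ i, StronglyMeasurable (g i)) → (∀ i, HasWeakDeriv Ω (Pi.single i 1) u (g i)) →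
      weightedEnergy Ω (U ∩ Ω) P n u ≤
        C * (weightedEnergy Ω Ω P (n + 1) u + ∑ i, weightedEnergy Ω Ω P (n + 1) (g i)) := by
  have hcpt : IsCompact (frontier Ω) := Metric.isCompact_of_isClosed_isBounded isClosed_frontier
    (hΩ.2.1.closure.subset frontier_subset_closure)
  -- Having a neighbourhood with a finite Hardy constant passes to subsets and, adding constants, to
  -- unions, so it need only be checked locally.
  refine hcpt.induction_on ?_ ?_ ?_ ?_
  · exact ⟨∅, isOpen_empty, Subset.rfl, 0, by simp, fun u g _ _ _ => by simp [weightedEnergy]⟩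
  · rintro s t hst ⟨U, hU, htU, h⟩
    exact ⟨U, hU, hst.trans htU, h⟩
  · rintro s t ⟨U, hU, hsU, C, hC, h⟩ ⟨U', hU', htU', C', hC', h'⟩
    refine ⟨U ∪ U', hU.union hU', union_subset_union hsU htU', C + C', by finiteness,
      fun u g hu hg hw => ?_⟩
    rw [union_inter_distrib_right, add_mul]
    exact weightedEnergy_union_le.trans (add_le_add (h u g hu hg hw) (h' u g hu hg hw))
  · intro q hq
    obtain ⟨U, hU, hqU, ⟨ch⟩⟩ := exists_boundaryChart hΩ hq
    obtain ⟨C, hC, h⟩ := ch.exists_hardy hΩ.1 hU hP n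
    obtain ⟨C', hC', h'⟩ := exists_weightedEnergy_sum_le Ω Ω hP (n + 1) ch.e
    refine ⟨U, mem_nhdsWithin_of_mem_nhds (hU.mem_nhds hqU), U, hU, Subset.rfl, C * (1 + C'),
      by finiteness, fun u g hu hg hw => ?_⟩
    have hgm : StronglyMeasurable fun x => ∑ i, ch.e i • g i x :=
      Finset.stronglyMeasurable_fun_sum _ fun i _ => (hg i).const_smul (ch.e i)
    refine (h u _ hu hgm (hasWeakLineDeriv_sum ch.e (hw 0).locallyIntegrableOn hw)).trans ?_
    rw [mul_assoc]
    gcongr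
    rw [mul_add]
    refine add_le_add ?_ ((h' g hg).trans ?_)
    · exact le_mul_of_one_le_left zero_le le_self_add
    · exact mul_le_mul_left le_add_self _

/-- Away from the boundary the powers of the distance are comparable. -/
theorem weightedEnergy_le_of_le_bdryDist {N : ℕ} {Ω S : Set (Eucl N)} (hS : MeasurableSet S)
    {P ε : ℝ} (hP : 0 < P) (hε : 0 < ε) (h : ∀ x ∈ S, ε ≤ bdryDist Ω x) (n : ℕ) (u : Eucl N → ℂ) :
    weightedEnergy Ω S P n u ≤ ENNReal.ofReal ε⁻¹ ^ P * weightedEnergy Ω S P (n + 1) u := by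
  rw [weightedEnergy, weightedEnergy, ← lintegral_const_mul' _ _
    (ENNReal.rpow_ne_top_of_nonneg hP.le ENNReal.ofReal_ne_top)]
  refine setLIntegral_mono' hS fun x hx => ?_
  rw [← ENNReal.mul_rpow_of_nonneg _ _ hP.le]
  refine ENNReal.rpow_le_rpow ?_ hP.le
  have h1 : 1 ≤ ENNReal.ofReal ε⁻¹ * ENNReal.ofReal (bdryDist Ω x) := by
    rw [← ENNReal.ofReal_mul (by positivity), ENNReal.one_le_ofReal, inv_mul_eq_div, one_le_div hε]
    exact h x hx
  refine (le_mul_of_one_le_left zero_le h1).trans_eq ?_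
  ring

/-- Hardy's inequality on a bounded Lipschitz domain. -/
theorem exists_hardy {d : ℕ} {Ω : Set (Eucl (d + 1))} (hΩ : IsBoundedLipschitzDomain Ω) {P : ℝ}
    (hP : 1 < P) (n : ℕ) : ∃ C : ℝ≥0∞, C ≠ ∞ ∧
      ∀ (u : Eucl (d + 1) → ℂ) (g : Fin (d + 1) → Eucl (d + 1) → ℂ),
      (∀ i, HasWeakDeriv Ω (Pi.single i 1) u (g i)) →
      weightedEnergy Ω Ω P n u ≤
        C * (weightedEnergy Ω Ω P (n + 1) u + ∑ i, weightedEnergy Ω Ω P (n + 1) (g i)) := by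
  have hP0 : 0 < P := by linarith
  obtain ⟨U, hU, hfU, C, hC, h⟩ := exists_hardy_near_frontier hΩ hP n
  have hcpt : IsCompact (frontier Ω) := Metric.isCompact_of_isClosed_isBounded isClosed_frontier
    (hΩ.2.1.closure.subset frontier_subset_closure)
  obtain ⟨ε, hε, hεU⟩ := hcpt.exists_thickening_subset_open hU hfU
  have hfar : ∀ x ∈ Ω \ U, ε ≤ bdryDist Ω x := by
    intro x hx
    -- `infDist` to the empty set is `0`, so a lower bound needs a nonempty boundary: a bounded set
    -- with a point is not the whole space.
    have hne : (frontier Ω).Nonempty := by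
      refine nonempty_frontier_iff.2 ⟨⟨x, hx.1⟩, ?_⟩
      rintro rfl
      exact NormedSpace.unbounded_univ ℝ (Eucl (d + 1)) hΩ.2.1
    refine (Metric.le_infDist hne).2 fun z hz => le_of_not_gt fun hlt => hx.2 (hεU ?_)
    exact Metric.mem_thickening_iff.2 ⟨z, hz, hlt⟩
  have hεt : ENNReal.ofReal ε⁻¹ ^ P ≠ ∞ :=
    ENNReal.rpow_ne_top_of_nonneg hP0.le ENNReal.ofReal_ne_top
  have hmeas : ∀ (u : Eucl (d + 1) → ℂ) (g : Fin (d + 1) → Eucl (d + 1) → ℂ), StronglyMeasurable u →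
      (∀ i, StronglyMeasurable (g i)) → (∀ i, HasWeakDeriv Ω (Pi.single i 1) u (g i)) →
      weightedEnergy Ω Ω P n u ≤ (C + ENNReal.ofReal ε⁻¹ ^ P) *
        (weightedEnergy Ω Ω P (n + 1) u + ∑ i, weightedEnergy Ω Ω P (n + 1) (g i)) := by
    intro u g hu hg hw
    have hsplit : Ω = U ∩ Ω ∪ Ω \ U := by rw [inter_comm, inter_union_sdiff]
    calc weightedEnergy Ω Ω P n u = weightedEnergy Ω (U ∩ Ω ∪ Ω \ U) P n u := by rw [← hsplit]
      _ ≤ weightedEnergy Ω (U ∩ Ω) P n u + weightedEnergy Ω (Ω \ U) P n u :=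
          weightedEnergy_union_le
      _ ≤ _ := by
          rw [add_mul]
          refine add_le_add (h u g hu hg hw) ?_
          refine (weightedEnergy_le_of_le_bdryDist
            (hΩ.1.measurableSet.diff hU.measurableSet) hP0 hε hfar n u).trans ?_
          gcongr
          exact (weightedEnergy_mono_set sdiff_subset).trans le_self_add
  refine ⟨C + ENNReal.ofReal ε⁻¹ ^ P, by finiteness, fun u g hw => ?_⟩
  -- Passing to strongly measurable representatives changes neither the energies nor the weak
  -- derivatives.
  have hu := (hw 0).locallyIntegrableOn.aestronglyMeasurable
  have hg := fun i => (hw i).locallyIntegrableOn_deriv.aestronglyMeasurable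
  have := hmeas (hu.mk u) (fun i => (hg i).mk (g i)) hu.stronglyMeasurable_mk
    (fun i => (hg i).stronglyMeasurable_mk) fun i => (hw i).congr hu.ae_eq_mk (hg i).ae_eq_mk
  rw [← weightedEnergy_congr hu.ae_eq_mk, ← weightedEnergy_congr hu.ae_eq_mk] at this
  simp_rw [← weightedEnergy_congr (hg _).ae_eq_mk] at this
  exact this

/-! ### The weighted Sobolev inequality -/

theorem MemSobolevLoc.hasWeakDeriv {N k : ℕ} {p : ℝ≥0∞} {Ω : Set (Eucl N)} {u : Eucl N → ℂ}
    (hu : MemSobolevLoc k p Ω u) {γ : MultiIndex N} (hγ : γ.order ≤ k) :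
    HasWeakDeriv Ω γ u (weakDeriv Ω γ u) :=
  (hu.2 γ hγ).choose_spec.1.hasWeakDeriv_weakDeriv

theorem eLpNorm_bdryDist_smul {N : ℕ} (Ω : Set (Eucl N)) {p : ℝ≥0∞} (hp0 : p ≠ 0) (hp : p ≠ ∞)
    (n : ℕ) (f : Eucl N → ℂ) :
    eLpNorm (fun x => bdryDist Ω x ^ n • f x) p (volume.restrict Ω) =
      weightedEnergy Ω Ω p.toReal n f ^ (1 / p.toReal) := by
  rw [eLpNorm_eq_lintegral_rpow_enorm_toReal hp0 hp, weightedEnergy]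
  congr 2
  funext x
  rw [enorm_smul, enorm_pow, Real.enorm_of_nonneg (show 0 ≤ bdryDist Ω x from Metric.infDist_nonneg)]

/-- Induction on the number `j` of powers of `δ` removed. Removing one more calls on the derivatives
`D^(α+e_i) u` at the previous stage, hence the bound `k - j` on the order of `α`. -/
theorem exists_weightedEnergy_weakDeriv_le {d : ℕ} {Ω : Set (Eucl (d + 1))}
    (hΩ : IsBoundedLipschitzDomain Ω) {p : ℝ≥0∞} (hp1 : 1 < p) (hp : p < ∞) (k m : ℕ)
    (hmk : m ≤ k) (j : ℕ) (hj : j ≤ m) : ∃ C : ℝ≥0∞, C ≠ ∞ ∧ ∀ u : Eucl (d + 1) → ℂ,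
      MemSobolevLoc k p Ω u → ∀ α : MultiIndex (d + 1), α.order ≤ k - j →
      weightedEnergy Ω Ω p.toReal (m - j) (weakDeriv Ω α u) ≤
        C * weightedSobolevNorm k p Ω (fun x => bdryDist Ω x ^ m) u ^ p.toReal := by
  have hP : 1 < p.toReal := by
    rw [← ENNReal.toReal_one]
    exact (ENNReal.toReal_lt_toReal ENNReal.one_ne_top hp.ne).2 hp1
  have hP0 : 0 < p.toReal := by linarith
  induction j with
  | zero =>
    refine ⟨1, by simp, fun u _ α hα => ?_⟩
    have h1 : eLpNorm (fun x => bdryDist Ω x ^ m • weakDeriv Ω α u x) p (volume.restrict Ω) ≤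
        weightedSobolevNorm k p Ω (fun x => bdryDist Ω x ^ m) u :=
      Finset.single_le_sum (f := fun γ => eLpNorm (fun x => bdryDist Ω x ^ m • weakDeriv Ω γ u x) p
        (volume.restrict Ω)) (fun _ _ => zero_le) (mem_multiIndices.2 hα)
    rw [eLpNorm_bdryDist_smul Ω (by positivity) hp.ne] at h1
    have h2 := ENNReal.rpow_le_rpow h1 hP0.le
    rwa [← ENNReal.rpow_mul, one_div_mul_cancel hP0.ne', ENNReal.rpow_one, ← one_mul (_ ^ _)] at h2
  | succ j ih =>
    obtain ⟨C, hC, h⟩ := ih (by omega)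
    obtain ⟨C', hC', h'⟩ := exists_hardy hΩ hP (m - (j + 1))
    -- One `C` bounds `D^α u` itself, and `d + 1` more bound its partial derivatives.
    refine ⟨C' * (C + (d + 1 : ℕ) * C), by finiteness, fun u hu α hα => ?_⟩
    have hord : ∀ i, (α + Pi.single i 1 : MultiIndex (d + 1)).order ≤ k - j := fun i => by
      rw [order_add_single]; omega
    have hstep := h' (weakDeriv Ω α u) (fun i => weakDeriv Ω (α + Pi.single i 1) u) fun i =>
      (hu.hasWeakDeriv (by omega)).of_add_single (hu.hasWeakDeriv ((hord i).trans (by omega)))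
    rw [show m - (j + 1) + 1 = m - j by omega] at hstep
    refine hstep.trans ?_
    rw [mul_assoc, add_mul]
    gcongr
    · exact h u hu α (by omega)
    · refine (Finset.sum_le_sum fun i _ => h u hu _ (hord i)).trans_eq ?_
      rw [Finset.sum_const, Finset.card_univ, Fintype.card_fin, nsmul_eq_mul, mul_assoc]

/-- The case `j = m = k - l` of the induction: the remaining weight is `δ^0`, and the orders allowed
are those up to `k - (k - l) = l`. -/
theorem exists_eLpNorm_weakDeriv_le {d : ℕ} {Ω : Set (Eucl (d + 1))}
    (hΩ : IsBoundedLipschitzDomain Ω) {p : ℝ≥0∞} (hp1 : 1 < p) (hp : p < ∞) (k l : ℕ)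
    (hlk : l ≤ k) : ∃ C : ℝ≥0∞, C ≠ ∞ ∧ ∀ u : Eucl (d + 1) → ℂ,
      MemSobolevLoc k p Ω u → ∀ α : MultiIndex (d + 1), α.order ≤ l →
      eLpNorm (weakDeriv Ω α u) p (volume.restrict Ω) ≤
        C * weightedSobolevNorm k p Ω (fun x => bdryDist Ω x ^ (k - l)) u := by
  have hP0 : 0 < p.toReal := ENNReal.toReal_pos (by positivity) hp.ne
  obtain ⟨C, hC, h⟩ :=
    exists_weightedEnergy_weakDeriv_le hΩ hp1 hp k (k - l) (Nat.sub_le _ _) (k - l) le_rfl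
  refine ⟨C ^ (1 / p.toReal), ENNReal.rpow_ne_top_of_nonneg (by positivity) hC,
    fun u hu α hα => ?_⟩
  have h1 := h u hu α (by omega)
  have h2 := eLpNorm_bdryDist_smul Ω (p := p) (by positivity) hp.ne 0 (weakDeriv Ω α u)
  simp only [pow_zero, one_smul] at h2
  rw [Nat.sub_self] at h1
  rw [h2]
  refine (ENNReal.rpow_le_rpow h1 (by positivity)).trans_eq ?_
  rw [ENNReal.mul_rpow_of_nonneg _ _ (by positivity), ← ENNReal.rpow_mul,
    mul_one_div_cancel hP0.ne', ENNReal.rpow_one]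

end WeightedSobolev

end

theorem mainTheorem10 (d : ℕ) (Ω : Set (WeightedSobolev.Eucl (d + 1)))
    (hΩ : WeightedSobolev.IsBoundedLipschitzDomain Ω)
    (p : ℝ≥0∞) (hp1 : 1 < p) (hp : p < ∞) (k l : ℕ) (hlk : l < k) :
    ∃ C : ℝ≥0, ∀ u : WeightedSobolev.Eucl (d + 1) → ℂ,
      WeightedSobolev.MemSobolevLoc k p Ω u →
      WeightedSobolev.weightedSobolevNorm k p Ω
        (fun x => WeightedSobolev.bdryDist Ω x ^ (k - l)) u < ∞ →
      WeightedSobolev.MemSobolev l p Ω u ∧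
        WeightedSobolev.sobolevNorm l p Ω u ≤
          C * WeightedSobolev.weightedSobolevNorm k p Ω
            (fun x => WeightedSobolev.bdryDist Ω x ^ (k - l)) u := by
  obtain ⟨C, hC, h⟩ := WeightedSobolev.exists_eLpNorm_weakDeriv_le hΩ hp1 hp k l hlk.le
  refine ⟨((WeightedSobolev.multiIndices (d + 1) l).card * C).toNNReal, fun u hu hfin => ?_⟩
  have hw : ∀ α : WeightedSobolev.MultiIndex (d + 1), α.order ≤ l →
      WeightedSobolev.HasWeakDeriv Ω α u (WeightedSobolev.weakDeriv Ω α u) := fun α hα =>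
    hu.hasWeakDeriv (hα.trans hlk.le)
  have hLp : ∀ α : WeightedSobolev.MultiIndex (d + 1), α.order ≤ l →
      MemLp (WeightedSobolev.weakDeriv Ω α u) p (volume.restrict Ω) := fun α hα =>
    ⟨(hw α hα).locallyIntegrableOn_deriv.aestronglyMeasurable,
      (h u hu α hα).trans_lt (ENNReal.mul_lt_top hC.lt_top hfin)⟩
  have h0 : (0 : WeightedSobolev.MultiIndex (d + 1)).order ≤ l := by
    simp [WeightedSobolev.MultiIndex.order]
  refine ⟨⟨?_, fun γ hγ => ⟨_, hw γ hγ, hLp γ hγ⟩⟩, ?_⟩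
  -- `weakDeriv Ω 0 u` is a chosen representative; uniqueness identifies it with `u` almost
  -- everywhere on `Ω`.
  · refine (hLp 0 h0).ae_eq ((ae_restrict_iff' hΩ.1.measurableSet).2 ?_)
    exact WeightedSobolev.HasWeakDeriv.ae_unique hΩ.1 (hw 0 h0)
      (WeightedSobolev.HasWeakDeriv.self (hw 0 h0).locallyIntegrableOn)
  · rw [ENNReal.coe_toNNReal (by finiteness), mul_assoc, ← nsmul_eq_mul, ← Finset.sum_const]
    exact Finset.sum_le_sum fun γ hγ => h u hu γ (WeightedSobolev.mem_multiIndices.1 hγ)
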